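/- For $k\ge 0$ let $\Lambda_k$ be the set of sequences $\lambda=(\lambda_1,\dots,\lambda_k)$ of $k$ positive integers; put $n=\lambda_1+\cdots+\lambda_k$, $s_\lambda^i=\lambda_1+\cdots+\lambda_i$ and $x^\lambda=x_1^{\lambda_1}\cdots x_k^{\lambda_k}$. A finite sequence is unimodal if it is strictly increasing up to some entry and strictly decreasing from that entry on. A permutation $\pi=\pi_1\pi_2\cdots\pi_n$ of $\{1,\dots,n\}$ is $\lambda$-unimodal if, when its one-line notation is cut into $k$ contiguous segments of lengths $\lambda_1,\dots,\lambda_k$ (in this order), every segment is unimodal. Let $\mathcal I^\lambda$ be the set of $\lambda$-unimodal permutations $\pi$ with $\pi^2=\mathrm{id}$. For $1\le i\le k$ let $\mathcal D_i^\lambda$ be the set of $\pi\in\mathcal I^\lambda$ such that $\pi_1\le s_\lambda^i$ and the first segment $\pi_1\cdots\pi_{\lambda_1}$ is decreasing, and for $1\le j\le k$ let $\mathcal I_j^\lambda$ be the set of $\pi\in\mathcal I^\lambda$ such that either $\pi_1\le s_\lambda^j$ and the first segment is decreasing, or $\pi_1>s_\lambda^j$. Define the formal power series $$L^k(\boldsymbol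 x)=\sum_{\lambda\in\Lambda_k}|\mathcal I^\lambda|\,x^\lambda,\qquad L_j^k(\boldsymbol x)=\sum_{\lambda\in\Lambda_k}|\mathcal I_j^\lambda|\,x^\lambda,\qquad D_i^k(\boldsymbol x)=\sum_{\lambda\in\Lambda_k}|\mathcal D_i^\lambda|\,x^\lambda$$ in $\boldsymbol x=(x_1,\dots,x_k)$. If $F$ is one of these series in $k-r$ variables, then $F(\boldsymbol x;\hat x_{i_1},\dots,\hat x_{i_r})$ denotes $F$ evaluated at the variables $x_1,\dots,x_k$ with $x_{i_1},\dots,x_{i_r}$ omitted, taken in increasing order of index. Then $L^0(\boldsymbol x)=1$, $L^1(\boldsymbol x)=\dfrac{x_1}{(1-x_1)^2}$, and for $k\ge2$ $$L^k(\boldsymbol x)=\frac1{1-x_1}\Big[x_1^2L_1^k(\boldsymbol x)+(x_1+x_1^2)L^{k-1}(\boldsymbol x;\hat x_1)+\sum_{i=2}^k x_1x_i\big[2L^{k-1}(\boldsymbol x;\hat x_1)+L_{i-1}^{k-1}(\boldsymbol x;\hat x_i)+L^{k-2}(\boldsymbol x;\hat x_1,\hat x_i)+L_i^k(\boldsymbol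 x)+L_{i-1}^k(\boldsymbol x)\big]\Big].$$ For $k\ge1$, $L_k^k(\boldsymbol x)=D_k^k(\boldsymbol x)$, and for $1\le j<k$ $$L_j^k(\boldsymbol x)=\frac1{1-x_1x_{j+1}}\Big[D_j^k(\boldsymbol x)+\sum_{i=j+2}^k x_1x_iL_{i-1}^k(\boldsymbol x)+\sum_{i=j+1}^k x_1x_i\big[2L^{k-1}(\boldsymbol x;\hat x_1)+L_{i-1}^{k-1}(\boldsymbol x;\hat x_i)+L^{k-2}(\boldsymbol x;\hat x_1,\hat x_i)+L_i^k(\boldsymbol x)\big]\Big].$$ For $k\ge1$, $D_1^k(\boldsymbol x)=\dfrac{x_1}{1-x_1}L^{k-1}(\boldsymbol x;\hat x_1)$, and for $1<i\le k$ $$D_i^k(\boldsymbol x)=\frac1{1-x_1x_i}\Big[D_{i-1}^k(\boldsymbol x)+x_1x_i\big[D_{i-1}^k(\boldsymbol x)+D_{i-1}^{k-1}(\boldsymbol x;\hat x_i)+L^{k-2}(\boldsymbol x;\hat x_1,\hat x_i)+2L^{k-1}(\boldsymbol x;\hat x_1)\big]\Big].$$ -/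

import Mathlib

/-- `λ_1 + ⋯ + λ_i`, for a sequence `l` whose entry `l j` is `λ_j` (indices start at `1`). -/
def partialSum (l : ℕ → ℕ) (i : ℕ) : ℕ := ∑ j ∈ Finset.Icc 1 i, l j

/-- `l` is a composition with exactly `k` parts `l 1, …, l k`: these are positive, and
`l` vanishes at all other indices. -/
def IsCompositionWithParts (k : ℕ) (l : ℕ →₀ ℕ) : Prop :=
  (∀ i, 1 ≤ i → i ≤ k → 0 < l i) ∧ (∀ i, ¬ (1 ≤ i ∧ i ≤ k) → l i = 0)

/-- The segment of the one-line notation of `π` at the (0-based) positions `a, …, b - 1` is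
unimodal: it increases up to some position `c` of the segment, and decreases from there on. -/
def IsUnimodalSegment {n : ℕ} (π : Equiv.Perm (Fin n)) (a b : ℕ) : Prop :=
  ∃ c : Fin n, a ≤ (c : ℕ) ∧ (c : ℕ) < b ∧
    StrictMonoOn π {p : Fin n | a ≤ (p : ℕ) ∧ p ≤ c} ∧
    StrictAntiOn π {p : Fin n | c ≤ p ∧ (p : ℕ) < b}

/-- `π` is `λ`-unimodal, for the composition `λ = (l 1, …, l k)`: for every `i ∈ {1, …, k}` the
`i`-th segment, which has length `l i`, is unimodal. -/
def IsLambdaUnimodal (k : ℕ) (l : ℕ → ℕ) (π : Equiv.Perm (Fin (partialSum l k))) : Prop :=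
  ∀ i, 1 ≤ i → i ≤ k → IsUnimodalSegment π (partialSum l (i - 1)) (partialSum l i)

/-- The value `π_1` in the 1-based one-line notation of `π` is at most `m`. -/
def FirstValueLE {n : ℕ} (π : Equiv.Perm (Fin n)) (m : ℕ) : Prop :=
  ∃ h : 0 < n, (π ⟨0, h⟩ : ℕ) + 1 ≤ m

/-- The value `π_1` in the 1-based one-line notation of `π` is greater than `m`. -/
def FirstValueGT {n : ℕ} (π : Equiv.Perm (Fin n)) (m : ℕ) : Prop :=
  ∃ h : 0 < n, m < (π ⟨0, h⟩ : ℕ) + 1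

/-- The first `m` entries of `π` are decreasing. -/
def IsInitiallyDecreasing {n : ℕ} (π : Equiv.Perm (Fin n)) (m : ℕ) : Prop :=
  StrictAntiOn π {p : Fin n | (p : ℕ) < m}

/-- The set `I^λ` of `λ`-unimodal involutions, for `λ = (l 1, …, l k)`. -/
def setI (k : ℕ) (l : ℕ → ℕ) : Set (Equiv.Perm (Fin (partialSum l k))) :=
  {π | Function.Involutive π ∧ IsLambdaUnimodal k l π}

/-- The set `I^λ_j`: the `λ`-unimodal involutions such that either `π_1 ≤ λ_1 + ⋯ + λ_j` and the
first segment is decreasing, or `π_1 > λ_1 + ⋯ + λ_j`. -/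
def setIj (k j : ℕ) (l : ℕ → ℕ) : Set (Equiv.Perm (Fin (partialSum l k))) :=
  {π | π ∈ setI k l ∧
    ((FirstValueLE π (partialSum l j) ∧ IsInitiallyDecreasing π (l 1)) ∨
      FirstValueGT π (partialSum l j))}

/-- The set `D^λ_i`: the `λ`-unimodal involutions such that `π_1 ≤ λ_1 + ⋯ + λ_i` and the first
segment is decreasing. -/
def setD (k i : ℕ) (l : ℕ → ℕ) : Set (Equiv.Perm (Fin (partialSum l k))) :=
  {π | π ∈ setI k l ∧ FirstValueLE π (partialSum l i) ∧ IsInitiallyDecreasing π (l 1)}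

/-- Formal power series over `ℚ`. The indeterminate `x_i` is `X i`, and a series in `x_1, …, x_k`
is regarded as a series in the indeterminates `x_i`, `i : ℕ`, in which no others occur. -/
abbrev Series : Type := MvPowerSeries ℕ ℚ

open Classical in
/-- The formal power series `∑_λ a(λ) x_1^{λ_1} ⋯ x_k^{λ_k}`, over all compositions `λ` with
exactly `k` parts. -/
noncomputable def compositionSeries (k : ℕ) (a : (ℕ → ℕ) → ℕ) : Series :=
  fun l : ℕ →₀ ℕ => if IsCompositionWithParts k l then (a l : ℚ) else 0

/-- The generating function `L^k` in `x_1, …, x_k`. -/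
noncomputable def genL (k : ℕ) : Series :=
  compositionSeries k fun l => (setI k l).ncard

/-- The generating function `L_j^k` in `x_1, …, x_k`. -/
noncomputable def genLj (k j : ℕ) : Series :=
  compositionSeries k fun l => (setIj k j l).ncard

/-- The generating function `D_i^k` in `x_1, …, x_k`. -/
noncomputable def genD (k i : ℕ) : Series :=
  compositionSeries k fun l => (setD k i l).ncard

/-- The increasing enumeration `0, …, i - 1, i + 1, i + 2, …` of the indices other than `i`. -/
def skipIndex (i : ℕ) : ℕ ↪ ℕ where
  toFun t := if t < i then t else t + 1
  inj' := by
    intro s t h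
    dsimp only at h
    split_ifs at h <;> omega

/-- `F(x; x̂_i)`: the series `F` in the indeterminates other than `x_i`, taken in their order.
That is, `x_1, …, x_{i-1}, x_i, x_{i+1}, …` are replaced by
`x_1, …, x_{i-1}, x_{i+1}, x_{i+2}, …`. For `1 ≤ i < j`, the series `F(x; x̂_i, x̂_j)` is
`hat j (hat i F)`. -/
noncomputable def hat (i : ℕ) (F : Series) : Series := MvPowerSeries.rename (skipIndex i) F

/-!
Everything follows from looking at the cycle `(1 m)` of the smallest value `1` of an involution `π`,
where `m = π_1`. Since `π_m = 1`, unimodality of the segment containing position `m` forces `m` to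
be the first or the last position of its segment. Conversely, deleting `1` and `m` and
standardising leaves an involution for the composition in which the first segment and the segment
`i` of `m` have each lost one element (possibly becoming empty); if `m = 1`, only the first segment
loses an element. Prolonging segment `i` at an end by
the value `1` is always allowed. Placing the value `m` in front of the first segment is
allowed iff this segment is decreasing or its first value exceeds `m`, and whether it does
can be read off from the segment of that first value, because `m` is an end of segment `i`.
Thus each choice of `i` and of an end of segment `i` contributes a term counted by the sets
`setIj`, or by the sets `setD` when the first segment is required to be decreasing.

To avoid renumbering, permutations act on an arbitrary finite linear order `α` cut into consecutive
blocks by a monotone map `b : α → ℕ`, blocks may be empty, and unimodality means the absence of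
valleys. Deletion is then restriction to a subtype (`ncard_unimodalInvolutions_swap`,
`ncard_decreasingWithin_swap`), and the counts depend only on the block sizes
(`HasBlockSizes.exists_orderIso`), so they become functions `numUnimodal`, `numDecreasingOrBeyond`,
`numDecreasingWithin` of an exponent vector `l : ℕ →₀ ℕ`. For these, omitting indeterminates from a
generating function just means prescribing another support of `l`, and multiplication by `x_i`
turns the sum of the series with and without `x_i` into a shift of the exponent
(`X_mul_supportSeries`). This is how the four kinds of terms in the brackets of the recurrences
arise from a single count (`supportSeries_sumOverEnds`).
-/

section

open Equiv

/-! ### Block-unimodal involutions -/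

/-- `π` is unimodal on every block (fibre) of `b`, expressed by the absence of valleys: an
injective sequence on a finite nonempty interval increases and then decreases iff no entry is
smaller than an earlier and a later one. Empty blocks are harmless in this form. -/
def IsBlockUnimodal {α : Type*} [LinearOrder α] (b : α → ℕ) (π : Perm α) : Prop :=
  ∀ p q r, p < q → q < r → b p = b q → b q = b r → π q < π p → π r < π q

/-- The involutions of `α` that are unimodal on every block of `b`. -/
def unimodalInvolutions {α : Type*} [LinearOrder α] (b : α → ℕ) : Set (Perm α) :=
  {π | Function.Involutive π ∧ IsBlockUnimodal b π}

/-- The block-unimodal involutions for which, within block `1`, an entry whose value lies in one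
of the blocks `0, …, j` is followed by smaller entries only. When block `1` is nonempty and `b` is
monotone, this means that `π` is decreasing on block `1` or its first value there lies in a block
beyond `j`; when block `1` is empty, it is no condition. -/
def decreasingOrBeyond {α : Type*} [LinearOrder α] (b : α → ℕ) (j : ℕ) : Set (Perm α) :=
  {π | π ∈ unimodalInvolutions b ∧
    ∀ q r, q < r → b q = 1 → b r = 1 → b (π q) ≤ j → π r < π q}

/-- The block-unimodal involutions that are decreasing on block `1`, with all values there in the
blocks `0, …, i`. -/
def decreasingWithin {α : Type*} [LinearOrder α] (b : α → ℕ) (i : ℕ) : Set (Perm α) :=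
  {π | π ∈ unimodalInvolutions b ∧ (∀ q, b q = 1 → b (π q) ≤ i) ∧
    ∀ q r, q < r → b q = 1 → b r = 1 → π r < π q}

section Transfer

variable {α β : Type*} [LinearOrder α] [LinearOrder β] {b : α → ℕ} {b' : β → ℕ}

theorem permCongr_mem_unimodalInvolutions_iff (e : α ≃o β)
    (h : ∀ x y, b' (e x) = b' (e y) ↔ b x = b y) (π : Perm α) :
    e.toEquiv.permCongr π ∈ unimodalInvolutions b' ↔ π ∈ unimodalInvolutions b := by
  simp only [unimodalInvolutions, Set.mem_ofPred_eq, IsBlockUnimodal, Function.Involutive]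
  simp only [e.surjective.forall]
  simp [Equiv.permCongr_apply, h]

theorem ncard_eq_of_permCongr {α β : Type*} (e : α ≃ β) {A : Set (Perm α)} {B : Set (Perm β)}
    (h : ∀ π, e.permCongr π ∈ B ↔ π ∈ A) : A.ncard = B.ncard := by
  rw [← Set.ncard_image_of_injective A e.permCongr.injective]
  congr 1
  ext σ
  constructor
  · rintro ⟨π, hπ, rfl⟩
    exact (h π).2 hπ
  · intro hσ
    exact ⟨e.permCongr.symm σ, (h _).1 (by rwa [Equiv.apply_symm_apply]),
      Equiv.apply_symm_apply _ σ⟩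

theorem ncard_unimodalInvolutions_congr (e : α ≃o β)
    (h : ∀ x y, b' (e x) = b' (e y) ↔ b x = b y) :
    (unimodalInvolutions b).ncard = (unimodalInvolutions b').ncard :=
  ncard_eq_of_permCongr e.toEquiv (permCongr_mem_unimodalInvolutions_iff e h)

theorem ncard_decreasingOrBeyond_congr (e : α ≃o β)
    (h : ∀ x y, b' (e x) = b' (e y) ↔ b x = b y) (h1 : ∀ x, b' (e x) = 1 ↔ b x = 1) {j j' : ℕ}
    (hj : ∀ x, b' (e x) ≤ j' ↔ b x ≤ j) :
    (decreasingOrBeyond b j).ncard = (decreasingOrBeyond b' j').ncard := by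
  refine ncard_eq_of_permCongr e.toEquiv fun π => ?_
  refine and_congr (permCongr_mem_unimodalInvolutions_iff e h π) ?_
  simp only [e.surjective.forall]
  simp [Equiv.permCongr_apply, h1, hj]

theorem ncard_decreasingWithin_congr (e : α ≃o β)
    (h : ∀ x y, b' (e x) = b' (e y) ↔ b x = b y) (h1 : ∀ x, b' (e x) = 1 ↔ b x = 1) {j j' : ℕ}
    (hj : ∀ x, b' (e x) ≤ j' ↔ b x ≤ j) :
    (decreasingWithin b j).ncard = (decreasingWithin b' j').ncard := by
  refine ncard_eq_of_permCongr e.toEquiv fun π => ?_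
  refine and_congr (permCongr_mem_unimodalInvolutions_iff e h π) ?_
  simp only [e.surjective.forall]
  simp [Equiv.permCongr_apply, h1, hj]

end Transfer

/-! ### Removal of the cycle of the least element -/

section Removal

variable {α : Type*}

/-- An involution that exchanges `a` and `c` (or fixes `a`, if `c = a`) amounts to an involution
of the remaining elements. So two sets of involutions that correspond under restriction have the
same size. -/
theorem ncard_eq_of_restrict [DecidableEq α] (a c : α) {A : Set (Perm α)}
    {B : Set (Perm {x : α // x ≠ a ∧ x ≠ c})}
    (hA : ∀ π ∈ A, Function.Involutive π ∧ π a = c) (hB : ∀ σ ∈ B, Function.Involutive σ)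
    (h : ∀ (π : Perm α) (σ : Perm {x : α // x ≠ a ∧ x ≠ c}), Function.Involutive π → π a = c →
      Function.Involutive σ → (∀ x, ((σ x : {x : α // x ≠ a ∧ x ≠ c}) : α) = π x) →
        (π ∈ A ↔ σ ∈ B)) :
    A.ncard = B.ncard := by
  let f : Perm {x : α // x ≠ a ∧ x ≠ c} → Perm α := fun σ => swap a c * σ.ofSubtype
  have hf (σ) (x : {x : α // x ≠ a ∧ x ≠ c}) : f σ x = σ x := by
    simp only [f, Perm.mul_apply, Perm.ofSubtype_apply_coe]
    exact swap_apply_of_ne_of_ne (σ x).2.1 (σ x).2.2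
  have hfa (σ) : f σ a = c := by
    simp [f, Perm.ofSubtype_apply_of_not_mem]
  have hfc (σ) : f σ c = a := by
    simp [f, Perm.ofSubtype_apply_of_not_mem]
  have hfinv (σ : Perm {x : α // x ≠ a ∧ x ≠ c}) (hσ : Function.Involutive σ) :
      Function.Involutive (f σ) := by
    intro x
    by_cases hxa : x = a
    · rw [hxa, hfa, hfc]
    by_cases hxc : x = c
    · rw [hxc, hfc, hfa]
    have := hf σ ⟨x, hxa, hxc⟩
    simp only at this
    rw [this, hf, hσ]
  have hinj : Function.Injective f := by
    intro σ τ hστ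
    ext x
    rw [← hf, ← hf, hστ]
  rw [← Set.ncard_image_of_injective B hinj]
  congr 1
  ext π
  constructor
  · intro hπ
    obtain ⟨hi, ha⟩ := hA π hπ
    have hc : π c = a := by rw [← ha, hi]
    have hst : ∀ x, (x ≠ a ∧ x ≠ c) ↔ (π x ≠ a ∧ π x ≠ c) := by
      intro x
      rw [← hc, ← ha, π.injective.ne_iff, ha, hc]
      rw [← ha, π.injective.ne_iff, ha]
      tauto
    let σ : Perm {x : α // x ≠ a ∧ x ≠ c} := π.subtypePerm fun x => (hst x).symm
    have hσ : ∀ x, ((σ x : {x : α // x ≠ a ∧ x ≠ c}) : α) = π x := fun x => rfl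
    have hσi : Function.Involutive σ := fun x => Subtype.ext (by rw [hσ, hσ, hi])
    refine ⟨σ, (h π σ hi ha hσi hσ).1 hπ, ?_⟩
    ext x
    by_cases hxa : x = a
    · rw [hxa, hfa, ha]
    by_cases hxc : x = c
    · rw [hxc, hfc, hc]
    exact (hf σ ⟨x, hxa, hxc⟩).trans (hσ _)
  · rintro ⟨σ, hσ, rfl⟩
    exact (h (f σ) σ (hfinv σ (hB σ hσ)) (hfa σ) (hB σ hσ) fun x => (hf σ x).symm).2 hσ

variable [LinearOrder α] {b : α → ℕ} {a c : α}

theorem ncard_unimodalInvolutions_fixed (ha : ∀ x, a ≤ x) :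
    {π ∈ unimodalInvolutions b | π a = a}.ncard =
      (unimodalInvolutions fun x : {x : α // x ≠ a ∧ x ≠ a} => b x).ncard := by
  refine ncard_eq_of_restrict a a (fun π h => ⟨h.1.1, h.2⟩) (fun σ h => h.1) ?_
  intro π σ hπ hπa hσ hσπ
  constructor
  · rintro ⟨⟨-, h⟩, -⟩
    refine ⟨hσ, fun p q r hpq hqr h1 h2 h3 => ?_⟩
    have := h p q r hpq hqr h1 h2
    rw [← hσπ, ← hσπ, ← hσπ] at this
    exact this h3
  · rintro ⟨-, h⟩
    refine ⟨⟨hπ, fun p q r hpq hqr h1 h2 h3 => ?_⟩, hπa⟩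
    by_cases hpa : p = a
    · rw [hpa, hπa] at h3
      exact absurd h3 (ha _).not_gt
    have hq : q ≠ a := (lt_of_le_of_lt (ha p) hpq).ne'
    have hr : r ≠ a := (lt_of_le_of_lt (ha q) hqr).ne'
    have := h ⟨p, hpa, hpa⟩ ⟨q, hq, hq⟩ ⟨r, hr, hr⟩ hpq hqr h1 h2
    simp only [← Subtype.coe_lt_coe, hσπ] at this
    exact this h3

/-- Removal of the 2-cycle formed by the least element `a` and an element `c` that is the first
or the last one of its block (the hypothesis `hc` says this, with `j` one less than the block of `c`
or equal to it). The value `a` at position `c` never spoils unimodality, while the value `c` at the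
front of block `1` requires that every entry below `c` in that block be followed by smaller ones
only. -/
theorem ncard_unimodalInvolutions_swap (ha : ∀ x, a ≤ x) (ha1 : b a = 1) (hca : c ≠ a) {j : ℕ}
    (hc : ∀ y, y ≠ c → (y < c ↔ b y ≤ j)) :
    {π ∈ unimodalInvolutions b | π a = c}.ncard =
      (decreasingOrBeyond (fun x : {x : α // x ≠ a ∧ x ≠ c} => b x) j).ncard := by
  refine ncard_eq_of_restrict a c (fun π h => ⟨h.1.1, h.2⟩) (fun σ h => h.1.1) ?_
  intro π σ hπ hπa hσ hσπ
  have hπc : π c = a := by rw [← hπa, hπ]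
  constructor
  · rintro ⟨⟨-, h⟩, -⟩
    refine ⟨⟨hσ, fun p q r hpq hqr h1 h2 h3 => ?_⟩, fun q r hqr hq hr hj => ?_⟩
    · have := h p q r hpq hqr h1 h2
      rw [← hσπ, ← hσπ, ← hσπ] at this
      exact this h3
    · have := h a q r (lt_of_le_of_ne (ha _) q.2.1.symm) hqr (ha1.trans hq.symm) (hq.trans hr.symm)
      rw [← hσπ, ← hσπ, hπa] at this
      exact this ((hc _ (σ q).2.2).2 hj)
  · rintro ⟨⟨-, h⟩, h'⟩
    refine ⟨⟨hπ, fun p q r hpq hqr h1 h2 h3 => ?_⟩, hπa⟩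
    have hqa : q ≠ a := (lt_of_le_of_lt (ha p) hpq).ne'
    have hra : r ≠ a := (lt_of_le_of_lt (ha q) hqr).ne'
    by_cases hpc : p = c
    · rw [hpc, hπc] at h3
      exact absurd h3 (ha _).not_gt
    by_cases hqc : q = c
    · -- an end of a block is not strictly between two elements of it
      subst hqc
      have := (hc p hpc).1 hpq
      have := (hc r hqr.ne').2 (by rw [← h2, ← h1]; exact this)
      exact absurd this hqr.not_gt
    by_cases hrc : r = c
    · rw [hrc, hπc]
      refine lt_of_le_of_ne (ha _) fun hh => hqc ?_
      rw [← hπa, hh, hπ]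
    have hval (x : α) (hx : x ≠ a ∧ x ≠ c) : π x = σ ⟨x, hx⟩ := (hσπ ⟨x, hx⟩).symm
    by_cases hpa : p = a
    · subst hpa
      rw [hπa, hval q ⟨hqa, hqc⟩, hc _ (σ _).2.2] at h3
      have := h' ⟨q, hqa, hqc⟩ ⟨r, hra, hrc⟩ hqr (h1.symm.trans ha1)
        (h2.symm.trans (h1.symm.trans ha1)) h3
      rw [hval q ⟨hqa, hqc⟩, hval r ⟨hra, hrc⟩]
      exact this
    · have := h ⟨p, hpa, hpc⟩ ⟨q, hqa, hqc⟩ ⟨r, hra, hrc⟩ hpq hqr h1 h2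
      simp only [← Subtype.coe_lt_coe, hσπ] at this
      exact this h3

/-- The variant of `ncard_unimodalInvolutions_swap` for involutions that are decreasing on block
`1`: after the removal, the values there must be smaller than `c`. -/
theorem ncard_decreasingWithin_swap (hb : Monotone b) (ha : ∀ x, a ≤ x) (ha1 : b a = 1)
    (hca : c ≠ a) {i j : ℕ} (hc : ∀ y, y ≠ c → (y < c ↔ b y ≤ j)) (hci : b c ≤ i) :
    {π ∈ decreasingWithin b i | π a = c}.ncard =
      (decreasingWithin (fun x : {x : α // x ≠ a ∧ x ≠ c} => b x) j).ncard := by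
  refine ncard_eq_of_restrict a c (fun π h => ⟨h.1.1.1, h.2⟩) (fun σ h => h.1.1) ?_
  intro π σ hπ hπa hσ hσπ
  have hπc : π c = a := by rw [← hπa, hπ]
  have hval (x : α) (hx : x ≠ a ∧ x ≠ c) : π x = σ ⟨x, hx⟩ := (hσπ ⟨x, hx⟩).symm
  constructor
  · rintro ⟨⟨⟨-, h⟩, -, hdec⟩, -⟩
    refine ⟨⟨hσ, fun p q r hpq hqr h1 h2 h3 => ?_⟩, fun q hq => ?_, fun q r hqr hq hr => ?_⟩
    · have := h p q r hpq hqr h1 h2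
      rw [← hσπ, ← hσπ, ← hσπ] at this
      exact this h3
    · rw [← hc _ (σ q).2.2, hσπ]
      exact (hdec a q (lt_of_le_of_ne (ha _) q.2.1.symm) ha1 hq).trans_eq hπa
    · have := hdec q r hqr hq hr
      rw [← hσπ, ← hσπ] at this
      exact this
  · rintro ⟨⟨-, h⟩, hlow, hdec⟩
    have hlt (x : α) (hx : x ≠ a ∧ x ≠ c) (hx1 : b x = 1) : π x < c := by
      rw [hval x hx, hc _ (σ _).2.2]
      exact hlow ⟨x, hx⟩ hx1
    have hdec' : ∀ q r, q < r → b q = 1 → b r = 1 → π r < π q := by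
      intro q r hqr hq hr
      have hra : r ≠ a := (lt_of_le_of_lt (ha q) hqr).ne'
      by_cases hqc : q = c
      · subst hqc
        have h1 := (hc a hca.symm).1 (lt_of_le_of_ne (ha _) hca.symm)
        have := (hc r hqr.ne').2 (by rw [hr, ← ha1]; exact h1)
        exact absurd this hqr.not_gt
      by_cases hrc : r = c
      · rw [hrc, hπc]
        refine lt_of_le_of_ne (ha _) fun hh => hqc ?_
        rw [← hπa, hh, hπ]
      by_cases hqa : q = a
      · rw [hqa, hπa]
        exact hlt r ⟨hra, hrc⟩ hr
      rw [hval q ⟨hqa, hqc⟩, hval r ⟨hra, hrc⟩]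
      exact hdec ⟨q, hqa, hqc⟩ ⟨r, hra, hrc⟩ hqr hq hr
    refine ⟨⟨⟨hπ, fun p q r hpq hqr h1 h2 h3 => ?_⟩, fun q hq => ?_, hdec'⟩, hπa⟩
    · have hqa : q ≠ a := (lt_of_le_of_lt (ha p) hpq).ne'
      have hra : r ≠ a := (lt_of_le_of_lt (ha q) hqr).ne'
      by_cases hp1 : b p = 1
      · exact hdec' q r hqr (h1 ▸ hp1) (h2 ▸ h1 ▸ hp1)
      have hpa : p ≠ a := fun hh => hp1 (hh ▸ ha1)
      by_cases hpc : p = c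
      · rw [hpc, hπc] at h3
        exact absurd h3 (ha _).not_gt
      by_cases hqc : q = c
      · subst hqc
        have := (hc p hpc).1 hpq
        have := (hc r hqr.ne').2 (by rw [← h2, ← h1]; exact this)
        exact absurd this hqr.not_gt
      by_cases hrc : r = c
      · rw [hrc, hπc]
        refine lt_of_le_of_ne (ha _) fun hh => hqc ?_
        rw [← hπa, hh, hπ]
      have := h ⟨p, hpa, hpc⟩ ⟨q, hqa, hqc⟩ ⟨r, hra, hrc⟩ hpq hqr h1 h2
      simp only [← Subtype.coe_lt_coe, hσπ] at this
      exact this h3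
    · by_cases hqa : q = a
      · rwa [hqa, hπa]
      by_cases hqc : q = c
      · rw [hqc, hπc, ha1, ← hq, hqc]
        exact hci
      exact (hb (hlt q ⟨hqa, hqc⟩ hq).le).trans hci

/-- In an involution, the position of the least value is the first value, so it is an
end of its block when that block is unimodal. -/
theorem apply_least_isEnd (ha : ∀ x, a ≤ x) {π : Perm α} (hπ : π ∈ unimodalInvolutions b) :
    (∀ y, b y = b (π a) → y ≤ π a) ∨ (∀ y, b y = b (π a) → π a ≤ y) := by
  by_contra! h
  obtain ⟨⟨r, hr, hr'⟩, ⟨p, hp, hp'⟩⟩ := h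
  have hlt (x : α) (hx : x ≠ π a) : π (π a) < π x := by
    rw [hπ.1 a]
    refine lt_of_le_of_ne (ha _) fun hh => hx ?_
    rw [hh, hπ.1]
  exact absurd (hπ.2 p (π a) r hp' hr' hp hr.symm (hlt p hp'.ne)) (hlt r hr'.ne').not_gt

/-- When block `1` starts with the least element `a`, the condition defining `decreasingOrBeyond`
takes the form used for `setIj`. -/
theorem mem_decreasingOrBeyond_iff (hb : Monotone b) (ha : ∀ x, a ≤ x) (ha1 : b a = 1) {j : ℕ}
    {π : Perm α} : π ∈ decreasingOrBeyond b j ↔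
      π ∈ decreasingWithin b j ∨ (π ∈ unimodalInvolutions b ∧ j < b (π a)) := by
  constructor
  · rintro ⟨hπ, h⟩
    by_cases hj : j < b (π a)
    · exact Or.inr ⟨hπ, hj⟩
    push Not at hj
    have hlt (r) (hr : r ≠ a) (hr1 : b r = 1) : π r < π a :=
      h a r (lt_of_le_of_ne (ha r) hr.symm) ha1 hr1 hj
    have hle (r) (hr1 : b r = 1) : b (π r) ≤ j := by
      by_cases hr : r = a
      · rwa [hr]
      · exact (hb (hlt r hr hr1).le).trans hj
    exact Or.inl ⟨hπ, hle, fun q r hqr hq hr => h q r hqr hq hr (hle q hq)⟩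
  · rintro (⟨hπ, -, h⟩ | ⟨hπ, hj⟩)
    · exact ⟨hπ, fun q r hqr hq hr _ => h q r hqr hq hr⟩
    · refine ⟨hπ, fun q r hqr hq hr hqj => ?_⟩
      have hlt : π q < π a := by
        by_contra! hh
        exact absurd (hb hh) (by omega)
      have hqa : a < q := lt_of_le_of_ne (ha q) (by rintro rfl; exact hlt.false)
      exact hπ.2 a q r hqa hqr (by rw [ha1, hq]) (by rw [hq, hr]) hlt

theorem mem_decreasingWithin_iff (hb : Monotone b) (ha : ∀ x, a ≤ x) (ha1 : b a = 1) {i : ℕ}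
    {π : Perm α} : π ∈ decreasingWithin b i ↔
      π ∈ unimodalInvolutions b ∧ b (π a) ≤ i ∧ ∀ q r, q < r → b q = 1 → b r = 1 → π r < π q := by
  refine and_congr_right fun _ => ⟨fun h => ⟨h.1 a ha1, h.2⟩, fun h => ⟨fun q hq => ?_, h.2⟩⟩
  rcases (ha q).eq_or_lt with rfl | hlt
  · exact h.1
  · exact (hb (h.2 a q hlt ha1 hq).le).trans h.1

end Removal

/-! ### Block sizes -/

/-- The block map `b` is monotone, and its fibre over `t` has `l t` elements: a finite linear order
is cut into consecutive, possibly empty, blocks of sizes `l 0, l 1, …`. -/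
def HasBlockSizes {α : Type*} [LinearOrder α] (b : α → ℕ) (l : ℕ →₀ ℕ) : Prop :=
  Monotone b ∧ ∀ t, {x | b x = t}.ncard = l t

theorem HasBlockSizes.ncard_le {α : Type*} [LinearOrder α] [Finite α] {b : α → ℕ} {l : ℕ →₀ ℕ}
    (h : HasBlockSizes b l) (t : ℕ) : {x | b x ≤ t}.ncard = ∑ j ∈ Finset.range (t + 1), l j := by
  induction t with
  | zero => simp [← h.2]
  | succ t ih =>
    rw [Finset.sum_range_succ, ← ih, ← h.2, ← Set.ncard_union_eq]
    · congr 1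
      ext x
      simp only [Set.mem_ofPred_eq, Set.mem_union]
      omega
    · rw [Set.disjoint_left]
      intro x hx hx'
      simp only [Set.mem_ofPred_eq] at hx hx'
      omega

/-- Finite linear orders cut into blocks are determined up to isomorphism by the block sizes. -/
theorem HasBlockSizes.exists_orderIso {α β : Type*} [LinearOrder α] [LinearOrder β] [Finite α]
    [Finite β] {b : α → ℕ} {b' : β → ℕ} {l : ℕ →₀ ℕ} (h : HasBlockSizes b l)
    (h' : HasBlockSizes b' l) : ∃ e : α ≃o β, ∀ x, b' (e x) = b x := by
  have hcard : Nat.card α = Nat.card β := by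
    obtain ⟨N, hN⟩ := (Set.finite_range b).bddAbove
    obtain ⟨N', hN'⟩ := (Set.finite_range b').bddAbove
    have h1 := h.ncard_le (max N N')
    have h2 := h'.ncard_le (max N N')
    rw [← h2] at h1
    rwa [Set.eq_univ_of_forall (s := {x | b x ≤ max N N'})
        (fun x => (hN ⟨x, rfl⟩).trans (le_max_left _ _)),
      Set.eq_univ_of_forall (s := {x | b' x ≤ max N N'})
        (fun x => (hN' ⟨x, rfl⟩).trans (le_max_right _ _)), Set.ncard_univ, Set.ncard_univ] at h1
  have := Fintype.ofFinite α
  have := Fintype.ofFinite β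
  rw [Nat.card_eq_fintype_card, Nat.card_eq_fintype_card] at hcard
  let e : α ≃o β := (Fintype.orderIsoFinOfCardEq α hcard).symm.trans
    (Fintype.orderIsoFinOfCardEq β rfl)
  refine ⟨e, ?_⟩
  -- initial segments of the same size are mapped onto each other
  have key (t : ℕ) (x : α) : b' (e x) ≤ t ↔ b x ≤ t := by
    have hlow : IsLowerSet {x | b x ≤ t} := fun x y hyx hx => (h.1 hyx).trans hx
    have hlow' : IsLowerSet {x | b' (e x) ≤ t} :=
      fun x y hyx hx => (h'.1 (e.monotone hyx)).trans hx
    have hc : {x | b x ≤ t}.ncard = {x | b' (e x) ≤ t}.ncard := by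
      rw [h.ncard_le, ← h'.ncard_le, ← Set.ncard_image_of_injective _ e.injective]
      congr 1
      ext y
      constructor
      · intro hy
        exact ⟨e.symm y, by simpa using hy, by simp⟩
      · rintro ⟨x, hx, rfl⟩
        exact hx
    have heq : {x | b x ≤ t} = {x | b' (e x) ≤ t} := by
      rcases hlow.total hlow' with hs | hs
      · exact Set.eq_of_subset_of_ncard_le hs hc.ge
      · exact (Set.eq_of_subset_of_ncard_le hs hc.le).symm
    exact (Set.ext_iff.1 heq x).symm
  intro x
  exact le_antisymm ((key _ x).2 le_rfl) ((key _ x).1 le_rfl)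

/-- The standard linear order cut into blocks of sizes `l 0, l 1, …`: pairs of a block and a
position in this block, ordered lexicographically. -/
abbrev BlockModel (l : ℕ →₀ ℕ) : Type := {p : ℕ ×ₗ ℕ // (ofLex p).2 < l (ofLex p).1}

/-- The block of an element of the standard model. -/
def BlockModel.block {l : ℕ →₀ ℕ} (p : BlockModel l) : ℕ := (ofLex p.1).1

instance (l : ℕ →₀ ℕ) : Finite (BlockModel l) := by
  let f : BlockModel l → Σ i : l.support, Fin (l i) := fun p =>
    ⟨⟨p.block, by
      rw [Finsupp.mem_support_iff]
      exact (Nat.zero_le _).trans_lt p.2 |>.ne'⟩, ⟨(ofLex p.1).2, p.2⟩⟩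
  refine Finite.of_injective f fun p q hpq => ?_
  obtain ⟨⟨p1, p2⟩, hp⟩ := p
  obtain ⟨⟨q1, q2⟩, hq⟩ := q
  simp only [f, BlockModel.block, Sigma.mk.injEq] at hpq
  obtain ⟨h1, h2⟩ := hpq
  replace h1 : p1 = q1 := congrArg Subtype.val h1
  subst h1
  have h3 := congrArg Fin.val (eq_of_heq h2)
  change p2 = q2 at h3
  subst h3
  rfl

theorem hasBlockSizes_blockModel (l : ℕ →₀ ℕ) :
    HasBlockSizes (BlockModel.block : BlockModel l → ℕ) l := by
  constructor
  · intro p q hpq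
    rcases (Prod.Lex.le_iff.1 (show p.1 ≤ q.1 from hpq)) with h | h
    · exact h.le
    · exact h.1.le
  · intro t
    have : Nat.card (Fin (l t)) = l t := by simp
    rw [← this, ← Set.ncard_univ, ← Set.ncard_image_of_injective (Set.univ : Set (Fin (l t)))
      (f := fun s => (⟨toLex (t, s.1), s.2⟩ : BlockModel l))]
    · congr 1
      ext p
      constructor
      · rintro rfl
        exact ⟨⟨(ofLex p.1).2, p.2⟩, trivial, rfl⟩
      · rintro ⟨s, -, rfl⟩
        rfl
    · intro s s' hs
      have h1 := congrArg Subtype.val hs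
      have h2 := congrArg (fun p => (ofLex p).2) h1
      exact Fin.ext h2

/-- The number of block-unimodal involutions for blocks of sizes `l 0, l 1, …`. -/
noncomputable def numUnimodal (l : ℕ →₀ ℕ) : ℕ :=
  (unimodalInvolutions (BlockModel.block : BlockModel l → ℕ)).ncard

/-- The size of `decreasingOrBeyond`, for blocks of sizes `l 0, l 1, …`. -/
noncomputable def numDecreasingOrBeyond (j : ℕ) (l : ℕ →₀ ℕ) : ℕ :=
  (decreasingOrBeyond (BlockModel.block : BlockModel l → ℕ) j).ncard

/-- The size of `decreasingWithin`, for blocks of sizes `l 0, l 1, …`. -/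
noncomputable def numDecreasingWithin (i : ℕ) (l : ℕ →₀ ℕ) : ℕ :=
  (decreasingWithin (BlockModel.block : BlockModel l → ℕ) i).ncard

section Counts

variable {α : Type*} [LinearOrder α] [Finite α] {b : α → ℕ} {l : ℕ →₀ ℕ}

theorem HasBlockSizes.ncard_unimodalInvolutions (h : HasBlockSizes b l) :
    (unimodalInvolutions b).ncard = numUnimodal l := by
  obtain ⟨e, he⟩ := h.exists_orderIso (hasBlockSizes_blockModel l)
  exact ncard_unimodalInvolutions_congr e fun x y => by rw [he, he]

theorem HasBlockSizes.ncard_decreasingOrBeyond (h : HasBlockSizes b l) (j : ℕ) :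
    (decreasingOrBeyond b j).ncard = numDecreasingOrBeyond j l := by
  obtain ⟨e, he⟩ := h.exists_orderIso (hasBlockSizes_blockModel l)
  exact ncard_decreasingOrBeyond_congr e (fun x y => by rw [he, he]) (fun x => by rw [he])
    (fun x => by rw [he])

theorem HasBlockSizes.ncard_decreasingWithin (h : HasBlockSizes b l) (i : ℕ) :
    (decreasingWithin b i).ncard = numDecreasingWithin i l := by
  obtain ⟨e, he⟩ := h.exists_orderIso (hasBlockSizes_blockModel l)
  exact ncard_decreasingWithin_congr e (fun x y => by rw [he, he]) (fun x => by rw [he])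
    (fun x => by rw [he])

theorem HasBlockSizes.nonempty_iff (h : HasBlockSizes b l) (t : ℕ) :
    (∃ x, b x = t) ↔ l t ≠ 0 := by
  rw [← h.2, Ne, Set.ncard_eq_zero, ← Ne, ← Set.nonempty_iff_ne_empty]
  rfl

/-- Block sizes after the removal of two elements. -/
theorem HasBlockSizes.remove_two (h : HasBlockSizes b l) {a c : α} (hca : c ≠ a) :
    HasBlockSizes (fun x : {x : α // x ≠ a ∧ x ≠ c} => b x)
      (l - Finsupp.single (b a) 1 - Finsupp.single (b c) 1) := by
  classical
  refine ⟨fun x y hxy => h.1 hxy, fun t => ?_⟩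
  have := Fintype.ofFinite α
  have h1 : {x : {x : α // x ≠ a ∧ x ≠ c} | b x = t}.ncard
      = (((Finset.univ.filter fun x => b x = t).erase a).erase c).card := by
    rw [← Set.ncard_image_of_injective _ Subtype.val_injective, ← Set.ncard_coe_finset]
    congr 1
    ext x
    simp
    tauto
  have h2 : (Finset.univ.filter fun x => b x = t).card = l t := by
    rw [← h.2 t, ← Set.ncard_coe_finset]
    congr 1
    ext x
    simp
  rw [h1, Finset.card_erase_eq_ite, Finset.card_erase_eq_ite, h2]
  simp only [Finset.mem_erase, Finset.mem_filter, Finset.mem_univ, true_and, hca, ne_eq,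
    not_false_eq_true, Finsupp.coe_tsub, Pi.sub_apply, Finsupp.single_apply]
  split_ifs <;> rfl

theorem HasBlockSizes.remove_one (h : HasBlockSizes b l) (a : α) :
    HasBlockSizes (fun x : {x : α // x ≠ a ∧ x ≠ a} => b x) (l - Finsupp.single (b a) 1) := by
  classical
  refine ⟨fun x y hxy => h.1 hxy, fun t => ?_⟩
  have := Fintype.ofFinite α
  have h1 : {x : {x : α // x ≠ a ∧ x ≠ a} | b x = t}.ncard
      = ((Finset.univ.filter fun x => b x = t).erase a).card := by
    rw [← Set.ncard_image_of_injective _ Subtype.val_injective, ← Set.ncard_coe_finset]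
    congr 1
    ext x
    simp
  have h2 : (Finset.univ.filter fun x => b x = t).card = l t := by
    rw [← h.2 t, ← Set.ncard_coe_finset]
    congr 1
    ext x
    simp
  rw [h1, Finset.card_erase_eq_ite, h2]
  simp only [Finset.mem_filter, Finset.mem_univ, true_and, Finsupp.coe_tsub, Pi.sub_apply,
    Finsupp.single_apply]
  split_ifs <;> rfl

end Counts

section Relabelling

variable {l : ℕ →₀ ℕ} {e : ℕ ↪ ℕ}

theorem hasBlockSizes_embDomain (l : ℕ →₀ ℕ) (he : StrictMono e) :
    HasBlockSizes (fun p : BlockModel l => e p.block) (l.embDomain e) := by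
  refine ⟨he.monotone.comp (hasBlockSizes_blockModel l).1, fun t => ?_⟩
  by_cases ht : t ∈ Set.range e
  · obtain ⟨t, rfl⟩ := ht
    rw [Finsupp.embDomain_apply_self, ← (hasBlockSizes_blockModel l).2 t]
    simp
  · rw [Finsupp.embDomain_of_notMem_range _ _ _ ht, Set.ncard_eq_zero]
    ext p
    simp only [Set.mem_ofPred_eq, Set.mem_empty_iff_false, iff_false]
    exact fun h => ht ⟨_, h⟩

theorem numUnimodal_embDomain (he : StrictMono e) :
    numUnimodal (l.embDomain e) = numUnimodal l := by
  rw [← (hasBlockSizes_embDomain l he).ncard_unimodalInvolutions]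
  exact (ncard_unimodalInvolutions_congr (OrderIso.refl (BlockModel l))
    fun x y => e.injective.eq_iff).symm

theorem numDecreasingOrBeyond_embDomain (he : StrictMono e) (h1 : e 1 = 1) (j : ℕ) :
    numDecreasingOrBeyond (e j) (l.embDomain e) = numDecreasingOrBeyond j l := by
  rw [← (hasBlockSizes_embDomain l he).ncard_decreasingOrBeyond]
  refine (ncard_decreasingOrBeyond_congr (OrderIso.refl (BlockModel l))
    (fun x y => e.injective.eq_iff) (fun x => ?_) fun x => he.le_iff_le).symm
  rw [← h1, e.injective.eq_iff, h1]
  rfl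

theorem numDecreasingWithin_embDomain (he : StrictMono e) (h1 : e 1 = 1) (j : ℕ) :
    numDecreasingWithin (e j) (l.embDomain e) = numDecreasingWithin j l := by
  rw [← (hasBlockSizes_embDomain l he).ncard_decreasingWithin]
  refine (ncard_decreasingWithin_congr (OrderIso.refl (BlockModel l))
    (fun x y => e.injective.eq_iff) (fun x => ?_) fun x => he.le_iff_le).symm
  rw [← h1, e.injective.eq_iff, h1]
  rfl

end Relabelling

section EmptyFirstBlock

variable {l : ℕ →₀ ℕ}

theorem block_ne_one (h : l 1 = 0) (p : BlockModel l) : p.block ≠ 1 := fun hp =>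
  ((hasBlockSizes_blockModel l).nonempty_iff 1).1 ⟨p, hp⟩ h

theorem numDecreasingOrBeyond_of_eq_zero (h : l 1 = 0) (j : ℕ) :
    numDecreasingOrBeyond j l = numUnimodal l := by
  simp [numDecreasingOrBeyond, numUnimodal, decreasingOrBeyond, block_ne_one h]

theorem numDecreasingWithin_of_eq_zero (h : l 1 = 0) (j : ℕ) :
    numDecreasingWithin j l = numUnimodal l := by
  simp [numDecreasingWithin, numUnimodal, decreasingWithin, block_ne_one h]

end EmptyFirstBlock

/-! ### Recurrences for the counts -/

section Recurrences

theorem ncard_eq_sum_ncard_fiber {β : Type*} [Finite β] (A : Set β) (f : β → ℕ) (S : Finset ℕ)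
    (h : ∀ x ∈ A, f x ∈ S) : A.ncard = ∑ t ∈ S, {x ∈ A | f x = t}.ncard := by
  classical
  have := Fintype.ofFinite β
  have hA (B : Set β) : B.ncard = (Finset.univ.filter (· ∈ B)).card := by
    rw [← Set.ncard_coe_finset]
    simp
  rw [hA, Finset.card_eq_sum_card_fiberwise (f := f) (t := S)]
  · refine Finset.sum_congr rfl fun t _ => ?_
    rw [hA, Finset.filter_filter]
    simp
  · intro x hx
    exact h x (by simpa using hx)

theorem HasBlockSizes.eq_of_block_eq {α : Type*} [LinearOrder α] {b : α → ℕ}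
    {l : ℕ →₀ ℕ} (h : HasBlockSizes b l) {t : ℕ} (ht : l t = 1) {x y : α}
    (hx : b x = t) (hy : b y = t) : x = y := by
  rw [← h.2, Set.ncard_eq_one] at ht
  obtain ⟨z, hz⟩ := ht
  have h1 : x ∈ ({z} : Set α) := hz ▸ hx
  have h2 : y ∈ ({z} : Set α) := hz ▸ hy
  rw [Set.mem_singleton_iff] at h1 h2
  rw [h1, h2]

theorem HasBlockSizes.eq_one {α : Type*} [LinearOrder α] {b : α → ℕ}
    {l : ℕ →₀ ℕ} (h : HasBlockSizes b l) {t : ℕ} {c : α} (hc : b c = t)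
    (h1 : ∀ y, b y = t → y ≤ c) (h2 : ∀ y, b y = t → c ≤ y) : l t = 1 := by
  rw [← h.2, Set.ncard_eq_one]
  refine ⟨c, ?_⟩
  ext y
  exact ⟨fun hy => le_antisymm (h1 y hy) (h2 y hy), fun hy => by rw [hy]; exact hc⟩

/-- The number of ways to insert a 2-cycle through the least element and an end of block `i`, where
`l` are the block sizes before the insertion and `F j l` counts the objects into which
the end directly beyond the blocks `0, …, j` can be inserted: the two ends of the block differ,
unless it was empty. -/
def sumOverEnds (F : ℕ → (ℕ →₀ ℕ) → ℕ) (i : ℕ) (l : ℕ →₀ ℕ) : ℕ :=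
  if l i = 0 then F (i - 1) l else F i l + F (i - 1) l

variable {α : Type*} [LinearOrder α] [Finite α] {b : α → ℕ} {l : ℕ →₀ ℕ} {a : α}

theorem HasBlockSizes.exists_least (h : HasBlockSizes b l) (h0 : l 0 = 0) (h1 : l 1 ≠ 0) :
    ∃ a, (∀ x, a ≤ x) ∧ b a = 1 := by
  obtain ⟨x, hx⟩ := (h.nonempty_iff 1).2 h1
  have : Nonempty α := ⟨x⟩
  obtain ⟨a, ha⟩ := Finite.exists_min (id : α → α)
  refine ⟨a, ha, ?_⟩
  have h2 : b a ≤ 1 := hx ▸ h.1 (ha x)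
  have h3 : b a ≠ 0 := fun h3 => (h.nonempty_iff 0).1 ⟨a, h3⟩ h0
  omega

theorem HasBlockSizes.exists_last (h : HasBlockSizes b l) {t : ℕ} (ht : l t ≠ 0) :
    ∃ c, b c = t ∧ (∀ y, b y = t → y ≤ c) ∧ ∀ y, y ≠ c → (y < c ↔ b y ≤ t) := by
  obtain ⟨c, hc, hmax⟩ := Set.exists_max_image {x | b x = t} id (Set.toFinite _)
    ((h.nonempty_iff t).2 ht)
  refine ⟨c, hc, hmax, fun y hy => ⟨fun hyc => hc ▸ h.1 hyc.le, fun hyt => ?_⟩⟩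
  rcases hyt.eq_or_lt with hyt | hyt
  · exact lt_of_le_of_ne (hmax y hyt) hy
  · exact h.1.reflect_lt (hyt.trans_eq hc.symm)

theorem HasBlockSizes.exists_first (h : HasBlockSizes b l) {t : ℕ} (ht : l t ≠ 0) (h0 : t ≠ 0) :
    ∃ c, b c = t ∧ (∀ y, b y = t → c ≤ y) ∧ ∀ y, y ≠ c → (y < c ↔ b y ≤ t - 1) := by
  obtain ⟨c, hc, hmin⟩ := Set.exists_min_image {x | b x = t} id (Set.toFinite _)
    ((h.nonempty_iff t).2 ht)
  refine ⟨c, hc, hmin, fun y hy => ⟨fun hyc => ?_, fun hyt => ?_⟩⟩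
  · have h1 : b y ≤ t := hc ▸ h.1 hyc.le
    have h2 : b y ≠ t := fun hh => hyc.not_ge (hmin y hh)
    omega
  · exact h.1.reflect_lt (by rw [hc]; omega)

/-- Splitting the involutions whose first value lies in block `t` by the end of the block that it
is. -/
theorem HasBlockSizes.ncard_apply_least_mem_block (h : HasBlockSizes b l) (ha : ∀ x, a ≤ x)
    (ha1 : b a = 1) {A : Set (Perm α)} (hA : A ⊆ unimodalInvolutions b) {t : ℕ} (ht : t ≠ 1)
    (htl : l t ≠ 0) (F : ℕ → (ℕ →₀ ℕ) → ℕ)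
    (hF : ∀ c j, c ≠ a → b c = t → (∀ y, y ≠ c → (y < c ↔ b y ≤ j)) →
      {π ∈ A | π a = c}.ncard = F j (l - Finsupp.single 1 1 - Finsupp.single t 1)) :
    {π ∈ A | b (π a) = t}.ncard =
      sumOverEnds F t (l - Finsupp.single 1 1 - Finsupp.single t 1) := by
  have ht0 : t ≠ 0 := by
    rintro rfl
    obtain ⟨x, hx⟩ := (h.nonempty_iff 0).2 htl
    have := h.1 (ha x)
    omega
  obtain ⟨c, hc, hc1, hc2⟩ := h.exists_last htl
  obtain ⟨d, hd, hd1, hd2⟩ := h.exists_first htl ht0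
  have hne (x) (hx : b x = t) : x ≠ a := by
    rintro rfl
    exact ht (hx.symm.trans ha1)
  have hun : {π ∈ A | b (π a) = t} = {π ∈ A | π a = c} ∪ {π ∈ A | π a = d} := by
    ext π
    constructor
    · rintro ⟨hπ, hπt⟩
      rcases apply_least_isEnd ha (hA hπ) with h1 | h1
      · exact Or.inl ⟨hπ, le_antisymm (hc1 _ hπt) (h1 c (hc.trans hπt.symm))⟩
      · exact Or.inr ⟨hπ, le_antisymm (h1 d (hd.trans hπt.symm)) (hd1 _ hπt)⟩
    · rintro (⟨hπ, hπc⟩ | ⟨hπ, hπd⟩)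
      · exact ⟨hπ, hπc ▸ hc⟩
      · exact ⟨hπ, hπd ▸ hd⟩
  have hlt : (l - Finsupp.single 1 1 - Finsupp.single t 1 : ℕ →₀ ℕ) t = l t - 1 := by
    simp [ht.symm]
  rw [hun, sumOverEnds, hlt]
  by_cases hcd : c = d
  · subst hcd
    rw [Set.union_self, h.eq_one hc hc1 hd1, if_pos rfl]
    exact hF c _ (hne c hc) hc hd2
  · have : l t ≠ 1 := fun h1 => hcd (h.eq_of_block_eq h1 hc hd)
    rw [if_neg (by omega), Set.ncard_union_eq, hF c _ (hne c hc) hc hc2, hF d _ (hne d hd) hd hd2]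
    rw [Set.disjoint_left]
    rintro π ⟨-, h1⟩ ⟨-, h2⟩
    exact hcd (h1.symm.trans h2)

theorem HasBlockSizes.ncard_unimodalInvolutions_mem_block (h : HasBlockSizes b l)
    (ha : ∀ x, a ≤ x) (ha1 : b a = 1) {t : ℕ} (ht : t ≠ 1) (htl : l t ≠ 0) :
    {π ∈ unimodalInvolutions b | b (π a) = t}.ncard =
      sumOverEnds numDecreasingOrBeyond t (l - Finsupp.single 1 1 - Finsupp.single t 1) := by
  refine h.ncard_apply_least_mem_block ha ha1 subset_rfl ht htl _ fun c j hca hc hj => ?_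
  have := h.remove_two hca
  rw [ha1, hc] at this
  rw [ncard_unimodalInvolutions_swap ha ha1 hca hj, this.ncard_decreasingOrBeyond]

theorem HasBlockSizes.ncard_decreasingWithin_mem_block (h : HasBlockSizes b l)
    (ha : ∀ x, a ≤ x) (ha1 : b a = 1) {t : ℕ} (ht : t ≠ 1) (htl : l t ≠ 0) :
    {π ∈ decreasingWithin b t | b (π a) = t}.ncard =
      sumOverEnds numDecreasingWithin t (l - Finsupp.single 1 1 - Finsupp.single t 1) := by
  refine h.ncard_apply_least_mem_block ha ha1 (fun π hπ => hπ.1) ht htl _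
    fun c j hca hc hj => ?_
  have := h.remove_two hca
  rw [ha1, hc] at this
  rw [ncard_decreasingWithin_swap h.1 ha ha1 hca hj hc.le, this.ncard_decreasingWithin]

/-- When the first value lies in block `1`, it is the least element or the last element of
block `1`. -/
theorem HasBlockSizes.ncard_unimodalInvolutions_mem_block_one (h : HasBlockSizes b l)
    (ha : ∀ x, a ≤ x) (ha1 : b a = 1) :
    {π ∈ unimodalInvolutions b | b (π a) = 1}.ncard =
      numUnimodal (l - Finsupp.single 1 1) + if (l - Finsupp.single 1 1 : ℕ →₀ ℕ) 1 = 0 then 0 else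
        numDecreasingOrBeyond 1 (l - Finsupp.single 1 1 - Finsupp.single 1 1) := by
  have h1 : l 1 ≠ 0 := (h.nonempty_iff 1).1 ⟨a, ha1⟩
  have hfix : {π ∈ unimodalInvolutions b | π a = a}.ncard =
      numUnimodal (l - Finsupp.single 1 1) := by
    have := h.remove_one a
    rw [ha1] at this
    rw [ncard_unimodalInvolutions_fixed ha, this.ncard_unimodalInvolutions]
  have hl1 : (l - Finsupp.single 1 1 : ℕ →₀ ℕ) 1 = l 1 - 1 := by simp
  rw [hl1, ← hfix]
  obtain ⟨c, hc, hc1, hc2⟩ := h.exists_last h1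
  have hun : {π ∈ unimodalInvolutions b | b (π a) = 1} =
      {π ∈ unimodalInvolutions b | π a = a} ∪ {π ∈ unimodalInvolutions b | π a = c} := by
    ext π
    constructor
    · rintro ⟨hπ, hπ1⟩
      rcases apply_least_isEnd ha hπ with h1 | h1
      · exact Or.inr ⟨hπ, le_antisymm (hc1 _ hπ1) (h1 c (hc.trans hπ1.symm))⟩
      · exact Or.inl ⟨hπ, le_antisymm (h1 a (ha1.trans hπ1.symm)) (ha _)⟩
    · rintro (⟨hπ, hπc⟩ | ⟨hπ, hπc⟩)
      · exact ⟨hπ, hπc.symm ▸ ha1⟩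
      · exact ⟨hπ, hπc ▸ hc⟩
  rw [hun]
  by_cases hca : c = a
  · subst hca
    rw [Set.union_self, h.eq_one hc hc1 fun y _ => ha y]
    simp
  · have : l 1 ≠ 1 := fun h1 => hca (h.eq_of_block_eq h1 hc ha1)
    rw [if_neg (by omega), Set.ncard_union_eq, ncard_unimodalInvolutions_swap ha ha1 hca hc2]
    · have := h.remove_two hca
      rw [ha1, hc] at this
      rw [this.ncard_decreasingOrBeyond]
    · rw [Set.disjoint_left]
      rintro π ⟨-, h1⟩ ⟨-, h2⟩
      exact hca (h2.symm.trans h1)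

theorem HasBlockSizes.mem_support (h : HasBlockSizes b l) (x : α) : b x ∈ l.support :=
  Finsupp.mem_support_iff.2 ((h.nonempty_iff _).1 ⟨x, rfl⟩)

/-- Block-unimodal involutions, counted by the cycle of the least element. -/
theorem numUnimodal_eq (h0 : l 0 = 0) (h1 : l 1 ≠ 0) :
    numUnimodal l = numUnimodal (l - Finsupp.single 1 1) +
      (if (l - Finsupp.single 1 1 : ℕ →₀ ℕ) 1 = 0 then 0 else
        numDecreasingOrBeyond 1 (l - Finsupp.single 1 1 - Finsupp.single 1 1)) +
      ∑ i ∈ l.support.erase 1,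
        sumOverEnds numDecreasingOrBeyond i (l - Finsupp.single 1 1 - Finsupp.single i 1) := by
  have h := hasBlockSizes_blockModel l
  obtain ⟨a, ha, ha1⟩ := h.exists_least h0 h1
  rw [← h.ncard_unimodalInvolutions_mem_block_one ha ha1]
  conv_lhs => rw [numUnimodal, ncard_eq_sum_ncard_fiber _ (fun π => (π a).block) l.support
    fun π _ => h.mem_support _]
  rw [← Finset.add_sum_erase _ _ (Finsupp.mem_support_iff.2 h1)]
  congr 1
  refine Finset.sum_congr rfl fun i hi => ?_
  rw [Finset.mem_erase, Finsupp.mem_support_iff] at hi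
  exact h.ncard_unimodalInvolutions_mem_block ha ha1 hi.1 hi.2

theorem numDecreasingOrBeyond_eq (h0 : l 0 = 0) (h1 : l 1 ≠ 0) {j : ℕ} (hj : 1 ≤ j) :
    numDecreasingOrBeyond j l = numDecreasingWithin j l +
      ∑ i ∈ l.support.filter (j < ·),
        sumOverEnds numDecreasingOrBeyond i (l - Finsupp.single 1 1 - Finsupp.single i 1) := by
  have h := hasBlockSizes_blockModel l
  obtain ⟨a, ha, ha1⟩ := h.exists_least h0 h1
  have hun : decreasingOrBeyond BlockModel.block j = decreasingWithin BlockModel.block j ∪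
      {π ∈ unimodalInvolutions BlockModel.block | j < (π a).block} := by
    ext π
    exact mem_decreasingOrBeyond_iff h.1 ha ha1
  rw [numDecreasingOrBeyond, numDecreasingWithin, hun, Set.ncard_union_eq]
  · congr 1
    rw [ncard_eq_sum_ncard_fiber _ (fun π => (π a).block) (l.support.filter (j < ·))
      fun π hπ => Finset.mem_filter.2 ⟨h.mem_support _, hπ.2⟩]
    refine Finset.sum_congr rfl fun i hi => ?_
    rw [Finset.mem_filter, Finsupp.mem_support_iff] at hi
    rw [← h.ncard_unimodalInvolutions_mem_block ha ha1 (by omega) hi.1]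
    congr 1
    ext π
    exact ⟨fun hπ => ⟨hπ.1.1, hπ.2⟩, fun hπ => ⟨⟨hπ.1, hi.2.trans_eq hπ.2.symm⟩, hπ.2⟩⟩
  · rw [Set.disjoint_left]
    rintro π hπ ⟨-, hπj⟩
    exact (hπ.2.1 a ha1).not_gt hπj

theorem numDecreasingWithin_eq (h0 : l 0 = 0) (h1 : l 1 ≠ 0) {i : ℕ} (hi : 1 < i)
    (hli : l i ≠ 0) :
    numDecreasingWithin i l = numDecreasingWithin (i - 1) l +
      sumOverEnds numDecreasingWithin i (l - Finsupp.single 1 1 - Finsupp.single i 1) := by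
  have h := hasBlockSizes_blockModel l
  obtain ⟨a, ha, ha1⟩ := h.exists_least h0 h1
  rw [← h.ncard_decreasingWithin_mem_block ha ha1 hi.ne' hli]
  have hun : decreasingWithin BlockModel.block i = decreasingWithin BlockModel.block (i - 1) ∪
      {π ∈ decreasingWithin BlockModel.block i | (π a).block = i} := by
    ext π
    simp only [Set.mem_union, Set.mem_ofPred_eq, mem_decreasingWithin_iff h.1 ha ha1]
    have : (π a).block ≤ i ↔ (π a).block ≤ i - 1 ∨ (π a).block = i := by omega
    rw [this]
    tauto
  have hnum : numDecreasingWithin i l = (decreasingWithin BlockModel.block (i - 1) ∪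
      {π ∈ decreasingWithin BlockModel.block i | (π a).block = i}).ncard := congrArg _ hun
  rw [hnum, Set.ncard_union_eq]
  · rfl
  · rw [Set.disjoint_left]
    rintro π hπ ⟨-, hπi⟩
    have := hπ.2.1 a ha1
    omega

/-- If block `1` is decreasing with values in itself, it is reversed, and the rest is arbitrary. -/
theorem numDecreasingWithin_one (h0 : l 0 = 0) :
    numDecreasingWithin 1 l = numUnimodal (l - Finsupp.single 1 (l 1)) := by
  induction hn : l 1 using Nat.strong_induction_on generalizing l with
  | _ n ih =>
  by_cases h1 : l 1 = 0
  · rw [numDecreasingWithin_of_eq_zero h1, ← hn, h1]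
    simp
  have h := hasBlockSizes_blockModel l
  obtain ⟨a, ha, ha1⟩ := h.exists_least h0 h1
  obtain ⟨c, hc, hc1, hc2⟩ := h.exists_last h1
  have hge (x : BlockModel l) : 1 ≤ x.block := ha1 ▸ h.1 (ha x)
  by_cases hca : c = a
  · subst hca
    have hl1 := h.eq_one hc hc1 fun y _ => ha y
    rw [← hn, hl1]
    have := h.remove_one c
    rw [ha1] at this
    rw [← this.ncard_unimodalInvolutions, ← ncard_unimodalInvolutions_fixed ha,
      numDecreasingWithin]
    congr 1
    ext π
    rw [mem_decreasingWithin_iff h.1 ha ha1]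
    constructor
    · rintro ⟨hπ, h2, -⟩
      exact ⟨hπ, h.eq_of_block_eq hl1 (le_antisymm h2 (hge _)) hc⟩
    · rintro ⟨hπ, h2⟩
      refine ⟨hπ, by rw [h2, hc], fun q r hqr hq hr => ?_⟩
      exact absurd (h.eq_of_block_eq hl1 hq hr) hqr.ne
  · have hl1 : l 1 ≠ 1 := fun h1 => hca (h.eq_of_block_eq h1 hc ha1)
    have hrem := h.remove_two hca
    rw [ha1, hc] at hrem
    have key : numDecreasingWithin 1 l =
        numDecreasingWithin 1 (l - Finsupp.single 1 1 - Finsupp.single 1 1) := by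
      rw [← hrem.ncard_decreasingWithin, ← ncard_decreasingWithin_swap h.1 ha ha1 hca hc2 hc.le,
        numDecreasingWithin]
      congr 1
      ext π
      refine ⟨fun hπ => ⟨hπ, ?_⟩, fun hπ => hπ.1⟩
      have hπ1 : (π a).block = 1 := le_antisymm (hπ.2.1 a ha1) (hge _)
      rcases apply_least_isEnd ha hπ.1 with h2 | h2
      · exact le_antisymm (hc1 _ hπ1) (h2 c (hc.trans hπ1.symm))
      · have hπa : π a = a := le_antisymm (h2 a (ha1.trans hπ1.symm)) (ha _)
        have := hπ.2.2 a c (lt_of_le_of_ne (ha c) (Ne.symm hca)) ha1 hc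
        rw [hπa] at this
        exact absurd this (ha _).not_gt
    rw [key, ih (l 1 - 2) (by omega) (by simp [h0]) (by simp; omega)]
    congr 1
    ext t
    by_cases ht : 1 = t
    · subst ht
      simp
      omega
    · simp [ht]

end Recurrences

/-! ### Segments of the one-line notation -/

section Segments

variable {k : ℕ} {l : ℕ →₀ ℕ}

theorem partialSum_mono (f : ℕ → ℕ) : Monotone (partialSum f) := fun _ _ hij =>
  Finset.sum_le_sum_of_subset (Finset.Icc_subset_Icc_right hij)

theorem partialSum_zero (f : ℕ → ℕ) : partialSum f 0 = 0 := by simp [partialSum]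

theorem partialSum_succ (f : ℕ → ℕ) (i : ℕ) : partialSum f (i + 1) = partialSum f i + f (i + 1) :=
  Finset.sum_Icc_succ_top (by omega) f

theorem isCompositionWithParts_iff : IsCompositionWithParts k l ↔ l.support = Finset.Icc 1 k := by
  rw [IsCompositionWithParts, Finset.ext_iff]
  simp only [Finsupp.mem_support_iff, Finset.mem_Icc]
  constructor
  · rintro ⟨h1, h2⟩ i
    exact ⟨fun h => by_contra fun h' => h (h2 i h'), fun h => (h1 i h.1 h.2).ne'⟩
  · intro h
    exact ⟨fun i h1 h2 => Nat.pos_of_ne_zero ((h i).2 ⟨h1, h2⟩),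
      fun i hi => by_contra fun h' => hi ((h i).1 h')⟩

/-- The index in `{1, …, k}` of the segment to which a (0-based) position belongs. -/
def segmentIndex (k : ℕ) (f : ℕ → ℕ) (p : Fin (partialSum f k)) : ℕ :=
  {i ∈ Finset.range k | partialSum f i ≤ p}.card

theorem segmentIndex_le (f : ℕ → ℕ) (p : Fin (partialSum f k)) : segmentIndex k f p ≤ k :=
  (Finset.card_filter_le _ _).trans_eq (Finset.card_range k)

theorem segmentIndex_le_iff (f : ℕ → ℕ) (p : Fin (partialSum f k)) {j : ℕ} (hj : j ≤ k) :
    segmentIndex k f p ≤ j ↔ (p : ℕ) < partialSum f j := by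
  rcases hj.eq_or_lt with rfl | hj
  · exact ⟨fun _ => p.2, fun _ => segmentIndex_le f p⟩
  constructor
  · intro h
    by_contra! hp
    have : Finset.range (j + 1) ⊆ {i ∈ Finset.range k | partialSum f i ≤ p} := fun i hi => by
      rw [Finset.mem_range] at hi
      exact Finset.mem_filter.2 ⟨Finset.mem_range.2 (by omega),
        (partialSum_mono f (by omega)).trans hp⟩
    have := Finset.card_le_card this
    rw [Finset.card_range] at this
    exact absurd (this.trans h) (by omega)
  · intro h
    have : {i ∈ Finset.range k | partialSum f i ≤ p} ⊆ Finset.range j := fun i hi => by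
      rw [Finset.mem_filter] at hi
      rw [Finset.mem_range]
      by_contra! hij
      exact absurd (h.trans_le (partialSum_mono f hij)) hi.2.not_gt
    exact (Finset.card_le_card this).trans_eq (Finset.card_range j)

theorem one_le_segmentIndex (f : ℕ → ℕ) (p : Fin (partialSum f k)) : 1 ≤ segmentIndex k f p := by
  by_contra! h
  have := (segmentIndex_le_iff f p (Nat.zero_le k)).1 (by omega)
  rw [partialSum_zero] at this
  omega

theorem segmentIndex_eq_iff (f : ℕ → ℕ) (p : Fin (partialSum f k)) {i : ℕ} (hi : 1 ≤ i)
    (hik : i ≤ k) : segmentIndex k f p = i ↔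
      partialSum f (i - 1) ≤ (p : ℕ) ∧ (p : ℕ) < partialSum f i := by
  have h1 := segmentIndex_le_iff f p hik
  have h2 := segmentIndex_le_iff f p (show i - 1 ≤ k by omega)
  omega

theorem segmentIndex_eq_one_iff (f : ℕ → ℕ) (p : Fin (partialSum f k)) (hk : 1 ≤ k) :
    segmentIndex k f p = 1 ↔ (p : ℕ) < f 1 := by
  rw [segmentIndex_eq_iff f p le_rfl hk]
  simp [partialSum]

theorem hasBlockSizes_segmentIndex (hl : IsCompositionWithParts k l) :
    HasBlockSizes (segmentIndex k l) l := by
  constructor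
  · intro p q hpq
    rw [segmentIndex_le_iff _ _ (segmentIndex_le _ _)]
    have := (segmentIndex_le_iff l q (segmentIndex_le l q)).1 le_rfl
    exact lt_of_le_of_lt hpq this
  · intro t
    by_cases ht : 1 ≤ t ∧ t ≤ k
    · simp only [segmentIndex_eq_iff l _ ht.1 ht.2]
      rw [← Set.ncard_image_of_injective _ Fin.val_injective]
      have : Fin.val '' {p : Fin (partialSum l k) | partialSum l (t - 1) ≤ (p : ℕ) ∧
          (p : ℕ) < partialSum l t} =
            (Finset.Ico (partialSum l (t - 1)) (partialSum l t) : Set ℕ) := by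
        ext x
        simp only [Set.mem_image, Set.mem_ofPred_eq, Finset.coe_Ico, Set.mem_Ico]
        constructor
        · rintro ⟨p, hp, rfl⟩
          exact hp
        · intro hx
          exact ⟨⟨x, hx.2.trans_le (partialSum_mono l ht.2)⟩, hx, rfl⟩
      rw [this, Set.ncard_coe_finset, Nat.card_Ico]
      obtain ⟨t, rfl⟩ : ∃ s, t = s + 1 := ⟨t - 1, by omega⟩
      rw [partialSum_succ]
      simp
    · rw [hl.2 t ht, Set.ncard_eq_zero]
      ext p
      simp only [Set.mem_ofPred_eq, Set.mem_empty_iff_false, iff_false]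
      rintro rfl
      exact ht ⟨one_le_segmentIndex _ _, segmentIndex_le _ _⟩

/-- A nonempty segment increases and then decreases iff it contains no valley. -/
theorem isUnimodalSegment_iff {n : ℕ} (π : Perm (Fin n)) {s t : ℕ} (hst : s < t) (ht : t ≤ n) :
    IsUnimodalSegment π s t ↔ ∀ p q r : Fin n, p < q → q < r → s ≤ (p : ℕ) → (r : ℕ) < t →
      π q < π p → π r < π q := by
  constructor
  · rintro ⟨c, -, -, hm, ha⟩ p q r hpq hqr hp hr h
    by_cases hqc : q ≤ c
    · exact absurd (hm ⟨hp, hpq.le.trans hqc⟩ ⟨hp.trans hpq.le, hqc⟩ hpq) h.not_gt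
    · push Not at hqc
      exact ha ⟨hqc.le, (show (q : ℕ) < r from hqr).trans hr⟩ ⟨hqc.le.trans hqr.le, hr⟩ hqr
  · intro h
    obtain ⟨c, ⟨hc1, hc2⟩, hmax⟩ := Set.exists_max_image
      {p : Fin n | s ≤ (p : ℕ) ∧ (p : ℕ) < t} π (Set.toFinite _)
      ⟨⟨s, hst.trans_le ht⟩, le_rfl, hst⟩
    refine ⟨c, hc1, hc2, ?_, ?_⟩
    · rintro p ⟨hp, hpc⟩ q ⟨hq, hqc⟩ hpq
      have hqt : (q : ℕ) < t := lt_of_le_of_lt hqc hc2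
      refine lt_of_le_of_ne ?_ (π.injective.ne hpq.ne)
      by_contra! hlt
      rcases hqc.eq_or_lt with rfl | hqc
      · exact absurd (hmax p ⟨hp, lt_of_le_of_lt hpc hc2⟩) hlt.not_ge
      · exact absurd (h p q c hpq hqc hp hc2 hlt) (hmax q ⟨hq, hqt⟩).not_gt
    · rintro p ⟨hcp, hp⟩ q ⟨hcq, hq⟩ hpq
      rcases hcp.eq_or_lt with rfl | hcp
      · exact lt_of_le_of_ne (hmax q ⟨hc1.trans hcq, hq⟩) (π.injective.ne hpq.ne')
      · have := hmax p ⟨hc1.trans hcp.le, hp⟩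
        exact h c p q hcp hpq hc1 hq (lt_of_le_of_ne this (π.injective.ne hcp.ne'))

theorem setI_eq (hl : IsCompositionWithParts k l) :
    setI k l = unimodalInvolutions (segmentIndex k l) := by
  ext π
  refine and_congr_right fun _ => ?_
  have key (i) (hi : 1 ≤ i) (hik : i ≤ k) := isUnimodalSegment_iff π
    (s := partialSum l (i - 1)) (t := partialSum l i) (by
      obtain ⟨i, rfl⟩ : ∃ s, i = s + 1 := ⟨i - 1, by omega⟩
      rw [partialSum_succ]
      have := hl.1 (i + 1) hi hik
      simp only [Nat.add_sub_cancel]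
      omega) (partialSum_mono l hik)
  constructor
  · intro h p q r hpq hqr h1 h2
    have hi := one_le_segmentIndex l p
    have hik := segmentIndex_le l p
    refine (key _ hi hik).1 (h _ hi hik) p q r hpq hqr ?_ ?_
    · exact ((segmentIndex_eq_iff l p hi hik).1 rfl).1
    · exact ((segmentIndex_eq_iff l r hi hik).1 (h2.symm.trans h1.symm)).2
  · intro h i hi hik
    rw [key i hi hik]
    intro p q r hpq hqr hp hr
    have hp' := (segmentIndex_eq_iff l p hi hik).2
      ⟨hp, ((show (p : ℕ) < q from hpq).trans hqr).trans hr⟩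
    have hq' := (segmentIndex_eq_iff l q hi hik).2
      ⟨hp.trans (show (p : ℕ) ≤ q from hpq.le), (show (q : ℕ) < r from hqr).trans hr⟩
    have hr' := (segmentIndex_eq_iff l r hi hik).2
      ⟨hp.trans (show (p : ℕ) ≤ r from (hpq.trans hqr).le), hr⟩
    exact h p q r hpq hqr (hp'.trans hq'.symm) (hq'.trans hr'.symm)

/-- For a composition with at least one part there is a first position, and it lies in the first
segment. -/
theorem exists_first_position (hl : IsCompositionWithParts k l) (hk : 1 ≤ k) :
    ∃ h : 0 < partialSum l k, (∀ x : Fin (partialSum l k), ⟨0, h⟩ ≤ x) ∧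
      segmentIndex k l ⟨0, h⟩ = 1 := by
  have h1 := hl.1 1 le_rfl hk
  have h : 0 < partialSum l k := h1.trans_le (by
    have := partialSum_mono l hk
    rwa [partialSum, Finset.Icc_self, Finset.sum_singleton] at this)
  exact ⟨h, fun x => Nat.zero_le _, (segmentIndex_eq_one_iff l _ hk).2 h1⟩

theorem isInitiallyDecreasing_iff (hk : 1 ≤ k) (π : Perm (Fin (partialSum l k))) :
    IsInitiallyDecreasing π (l 1) ↔ ∀ q r, q < r → segmentIndex k l q = 1 →
      segmentIndex k l r = 1 → π r < π q := by
  simp only [segmentIndex_eq_one_iff l _ hk]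
  exact ⟨fun h q r hqr hq hr => h hq hr hqr, fun h q hq r hr hqr => h q r hqr hq hr⟩

theorem firstValueLE_iff (h : 0 < partialSum l k) (π : Perm (Fin (partialSum l k))) {j : ℕ}
    (hj : j ≤ k) : FirstValueLE π (partialSum l j) ↔ segmentIndex k l (π ⟨0, h⟩) ≤ j := by
  rw [segmentIndex_le_iff l _ hj]
  exact ⟨fun ⟨_, h⟩ => h, fun h' => ⟨h, h'⟩⟩

theorem firstValueGT_iff (h : 0 < partialSum l k) (π : Perm (Fin (partialSum l k))) {j : ℕ}
    (hj : j ≤ k) : FirstValueGT π (partialSum l j) ↔ j < segmentIndex k l (π ⟨0, h⟩) := by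
  rw [← not_le, segmentIndex_le_iff l _ hj, not_lt, ← Nat.lt_succ_iff]
  exact ⟨fun ⟨_, h⟩ => h, fun h' => ⟨h, h'⟩⟩

theorem setD_eq (hl : IsCompositionWithParts k l) {i : ℕ} (hk : 1 ≤ k) (hi : i ≤ k) :
    setD k i l = decreasingWithin (segmentIndex k l) i := by
  obtain ⟨h, ha, ha1⟩ := exists_first_position hl hk
  ext π
  rw [mem_decreasingWithin_iff (hasBlockSizes_segmentIndex hl).1 ha ha1, ← setI_eq hl,
    ← isInitiallyDecreasing_iff hk, ← firstValueLE_iff h π hi]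
  rfl

theorem setIj_eq (hl : IsCompositionWithParts k l) {j : ℕ} (hk : 1 ≤ k) (hj : j ≤ k) :
    setIj k j l = decreasingOrBeyond (segmentIndex k l) j := by
  obtain ⟨h, ha, ha1⟩ := exists_first_position hl hk
  ext π
  rw [mem_decreasingOrBeyond_iff (hasBlockSizes_segmentIndex hl).1 ha ha1, ← setD_eq hl hk hj,
    ← setI_eq hl, ← firstValueGT_iff h π hj]
  simp only [setIj, setD, Set.mem_ofPred_eq]
  tauto

theorem ncard_setI (hl : IsCompositionWithParts k l) : (setI k l).ncard = numUnimodal l := by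
  rw [setI_eq hl, (hasBlockSizes_segmentIndex hl).ncard_unimodalInvolutions]

theorem ncard_setIj (hl : IsCompositionWithParts k l) {j : ℕ} (hk : 1 ≤ k) (hj : j ≤ k) :
    (setIj k j l).ncard = numDecreasingOrBeyond j l := by
  rw [setIj_eq hl hk hj, (hasBlockSizes_segmentIndex hl).ncard_decreasingOrBeyond]

theorem ncard_setD (hl : IsCompositionWithParts k l) {i : ℕ} (hk : 1 ≤ k) (hi : i ≤ k) :
    (setD k i l).ncard = numDecreasingWithin i l := by
  rw [setD_eq hl hk hi, (hasBlockSizes_segmentIndex hl).ncard_decreasingWithin]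

end Segments

/-! ### Generating functions -/

section GeneratingFunctions

open MvPowerSeries

/-- The series `∑ f(l) x^l` over all `l` in which exactly the indeterminates in `S` occur. -/
def supportSeries (S : Finset ℕ) (f : (ℕ →₀ ℕ) → ℕ) : Series :=
  fun l : ℕ →₀ ℕ => if l.support = S then (f l : ℚ) else 0

theorem coeff_supportSeries (S : Finset ℕ) (f : (ℕ →₀ ℕ) → ℕ) (l : ℕ →₀ ℕ) :
    coeff l (supportSeries S f) = if l.support = S then (f l : ℚ) else 0 := rfl

theorem supportSeries_congr {S : Finset ℕ} {f g : (ℕ →₀ ℕ) → ℕ}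
    (h : ∀ l : ℕ →₀ ℕ, l.support = S → f l = g l) : supportSeries S f = supportSeries S g := by
  ext l
  rw [coeff_supportSeries, coeff_supportSeries]
  split_ifs with hl
  · rw [h l hl]
  · rfl

theorem supportSeries_add (S : Finset ℕ) (f g : (ℕ →₀ ℕ) → ℕ) :
    supportSeries S (fun l => f l + g l) = supportSeries S f + supportSeries S g := by
  ext l
  simp only [map_add, coeff_supportSeries]
  split_ifs <;> simp

theorem supportSeries_sum {ι : Type*} (S : Finset ℕ) (T : Finset ι) (f : ι → (ℕ →₀ ℕ) → ℕ) :
    supportSeries S (fun l => ∑ i ∈ T, f i l) = ∑ i ∈ T, supportSeries S (f i) := by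
  ext l
  simp only [map_sum, coeff_supportSeries]
  split_ifs <;> simp

/-- Multiplication by `x_i` shifts the exponent of `x_i`; the terms in which `x_i` gets exponent `1`
come from the series without `x_i`. -/
theorem X_mul_supportSeries {S : Finset ℕ} {i : ℕ} (hi : i ∈ S) (f : (ℕ →₀ ℕ) → ℕ) :
    X i * (supportSeries S f + supportSeries (S.erase i) f) =
      supportSeries S fun l => f (l - Finsupp.single i 1) := by
  ext l
  rw [X, coeff_monomial_mul, map_add]
  simp only [coeff_supportSeries, one_mul, Finsupp.single_le_iff]
  have hsupp (h : l i ≠ 1) : (l - Finsupp.single i 1).support = l.support := by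
    ext t
    by_cases ht : i = t
    · subst ht
      simp
      omega
    · simp [ht]
  have hsupp' (h : l i = 1) : (l - Finsupp.single i 1).support = l.support.erase i := by
    ext t
    by_cases ht : i = t
    · subst ht
      simp [h]
    · simp [Ne.symm ht]
  by_cases h1 : l i = 1
  · have hil : i ∈ l.support := by simp [h1]
    rw [hsupp' h1, if_pos h1.ge, if_neg (c := l.support.erase i = S)
      fun h => Finset.notMem_erase i l.support (h ▸ hi), zero_add]
    have : l.support.erase i = S.erase i ↔ l.support = S :=
      ⟨fun h => by rw [← Finset.insert_erase hil, h, Finset.insert_erase hi], fun h => by rw [h]⟩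
    simp only [this]
  by_cases h0 : l i = 0
  · have hil : i ∉ l.support := by simp [h0]
    rw [if_neg (by omega), if_neg]
    rintro rfl
    exact hil hi
  · have hil : i ∈ l.support := by simp [h0]
    rw [hsupp h1, if_pos (by omega),
      if_neg (c := l.support = S.erase i) fun h => Finset.notMem_erase i S (h ▸ hil), add_zero]

theorem skipIndex_strictMono (i : ℕ) : StrictMono (skipIndex i) := by
  intro s t hst
  change (if s < i then s else s + 1) < (if t < i then t else t + 1)
  split_ifs <;> omega

theorem skipIndex_of_lt {i t : ℕ} (h : t < i) : skipIndex i t = t := if_pos h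

theorem hat_supportSeries (i : ℕ) {S T : Finset ℕ} {f g : (ℕ →₀ ℕ) → ℕ}
    (hT : S.map (skipIndex i) = T) (h : ∀ l, g (l.embDomain (skipIndex i)) = f l) :
    hat i (supportSeries S f) = supportSeries T g := by
  subst hT
  ext l
  by_cases hl : l ∈ Set.range (Finsupp.embDomain (skipIndex i))
  · obtain ⟨l, rfl⟩ := hl
    rw [hat, coeff_embDomain_rename, coeff_supportSeries, coeff_supportSeries,
      Finsupp.support_embDomain, h]
    simp only [Finset.map_inj]
  · rw [hat, coeff_rename_eq_zero, coeff_supportSeries, if_neg]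
    · intro hs
      refine hl ((Finsupp.mem_range_embDomain_iff _ _).2 ?_)
      rw [hs, Finset.coe_map]
      exact Set.image_subset_range _ _
    · rintro ⟨m, rfl⟩
      exact hl ⟨m, Finsupp.embDomain_eq_mapDomain _ _⟩

theorem map_skipIndex_Icc {k i : ℕ} (hi : 1 ≤ i) (hik : i ≤ k) :
    (Finset.Icc 1 (k - 1)).map (skipIndex i) = (Finset.Icc 1 k).erase i := by
  ext x
  simp only [Finset.mem_map, Finset.mem_Icc, Finset.mem_erase]
  constructor
  · rintro ⟨y, hy, rfl⟩
    change (if y < i then y else y + 1) ≠ i ∧ 1 ≤ (if y < i then y else y + 1) ∧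
      (if y < i then y else y + 1) ≤ k
    split_ifs <;> omega
  · intro hx
    by_cases hxi : x < i
    · exact ⟨x, by omega, skipIndex_of_lt hxi⟩
    · refine ⟨x - 1, by omega, ?_⟩
      change (if x - 1 < i then x - 1 else x - 1 + 1) = x
      split_ifs <;> omega

variable {k i j : ℕ}

theorem compositionSeries_eq (k : ℕ) {a : (ℕ → ℕ) → ℕ} {f : (ℕ →₀ ℕ) → ℕ}
    (h : ∀ l : ℕ →₀ ℕ, IsCompositionWithParts k l → a l = f l) :
    compositionSeries k a = supportSeries (Finset.Icc 1 k) f := by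
  ext l
  classical
  rw [coeff_supportSeries]
  change compositionSeries k a l = _
  rw [compositionSeries, isCompositionWithParts_iff]
  split_ifs with hl
  · rw [h l (isCompositionWithParts_iff.2 hl)]
  · rfl

theorem genL_eq (k : ℕ) : genL k = supportSeries (Finset.Icc 1 k) numUnimodal :=
  compositionSeries_eq k fun _ => ncard_setI

theorem genLj_eq (hk : 1 ≤ k) (hj : j ≤ k) :
    genLj k j = supportSeries (Finset.Icc 1 k) (numDecreasingOrBeyond j) :=
  compositionSeries_eq k fun _ hl => ncard_setIj hl hk hj

theorem genD_eq (hk : 1 ≤ k) (hi : i ≤ k) :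
    genD k i = supportSeries (Finset.Icc 1 k) (numDecreasingWithin i) :=
  compositionSeries_eq k fun _ hl => ncard_setD hl hk hi

theorem hat_one_genL (hk : 1 ≤ k) :
    hat 1 (genL (k - 1)) = supportSeries ((Finset.Icc 1 k).erase 1) numUnimodal := by
  rw [genL_eq]
  exact hat_supportSeries 1 (map_skipIndex_Icc le_rfl hk)
    fun l => numUnimodal_embDomain (skipIndex_strictMono 1)

theorem hat_hat_genL (hi : 1 < i) (hik : i ≤ k) : hat i (hat 1 (genL (k - 2))) =
    supportSeries (((Finset.Icc 1 k).erase 1).erase i) numUnimodal := by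
  rw [show k - 2 = k - 1 - 1 by omega, hat_one_genL (by omega)]
  refine hat_supportSeries i ?_ fun l => numUnimodal_embDomain (skipIndex_strictMono i)
  have := Finset.map_erase (skipIndex i) (Finset.Icc 1 (k - 1)) 1
  rw [this, skipIndex_of_lt hi, map_skipIndex_Icc hi.le hik, Finset.erase_right_comm]

theorem hat_genLj (hi : 1 < i) (hik : i ≤ k) : hat i (genLj (k - 1) (i - 1)) =
    supportSeries ((Finset.Icc 1 k).erase i) (numDecreasingOrBeyond (i - 1)) := by
  rw [genLj_eq (by omega) (by omega)]
  refine hat_supportSeries i (map_skipIndex_Icc hi.le hik) fun l => ?_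
  have := numDecreasingOrBeyond_embDomain (l := l) (skipIndex_strictMono i) (skipIndex_of_lt hi)
    (i - 1)
  rwa [skipIndex_of_lt (by omega)] at this

theorem hat_genD (hi : 1 < i) (hik : i ≤ k) : hat i (genD (k - 1) (i - 1)) =
    supportSeries ((Finset.Icc 1 k).erase i) (numDecreasingWithin (i - 1)) := by
  rw [genD_eq (by omega) (by omega)]
  refine hat_supportSeries i (map_skipIndex_Icc hi.le hik) fun l => ?_
  have := numDecreasingWithin_embDomain (l := l) (skipIndex_strictMono i) (skipIndex_of_lt hi)
    (i - 1)
  rwa [skipIndex_of_lt (by omega)] at this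

/-- The generating function of insertions of a 2-cycle between block `1` and block `i`. The four
kinds of terms correspond to which of the two blocks are empty before the insertion. -/
theorem supportSeries_sumOverEnds (hi : 1 < i) (hik : i ≤ k) {F : ℕ → (ℕ →₀ ℕ) → ℕ}
    (hF : ∀ j l, l 1 = 0 → F j l = numUnimodal l) :
    supportSeries (Finset.Icc 1 k)
        (fun l => sumOverEnds F i (l - Finsupp.single 1 1 - Finsupp.single i 1)) =
      X 1 * X i * (2 * hat 1 (genL (k - 1)) +
        supportSeries ((Finset.Icc 1 k).erase i) (F (i - 1)) + hat i (hat 1 (genL (k - 2))) +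
        supportSeries (Finset.Icc 1 k) (F i) + supportSeries (Finset.Icc 1 k) (F (i - 1))) := by
  have h1k : 1 ∈ Finset.Icc 1 k := Finset.mem_Icc.2 (by omega)
  have hik' : i ∈ Finset.Icc 1 k := Finset.mem_Icc.2 (by omega)
  have hne (l : ℕ →₀ ℕ) {S : Finset ℕ} (hl : l.support = S) (hS : i ∈ S) : l i ≠ 0 := by
    rwa [← Finsupp.mem_support_iff, hl]
  have h0 (l : ℕ →₀ ℕ) {S : Finset ℕ} (t : ℕ) (hl : l.support = S) (hS : t ∉ S) : l t = 0 := by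
    rwa [← Finsupp.notMem_support_iff, hl]
  have hi' : i ∈ (Finset.Icc 1 k).erase 1 := Finset.mem_erase.2 ⟨hi.ne', hik'⟩
  rw [hat_one_genL (by omega), hat_hat_genL hi hik]
  rw [← X_mul_supportSeries h1k fun l => sumOverEnds F i (l - Finsupp.single i 1),
    ← X_mul_supportSeries hik', ← X_mul_supportSeries hi']
  rw [supportSeries_congr (S := Finset.Icc 1 k) (f := sumOverEnds F i)
      (g := fun l => F i l + F (i - 1) l) fun l hl => if_neg (hne l hl hik'),
    supportSeries_congr (S := (Finset.Icc 1 k).erase i) (f := sumOverEnds F i)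
      (g := F (i - 1)) fun l hl => if_pos (h0 l i hl (Finset.notMem_erase _ _)),
    supportSeries_congr (S := (Finset.Icc 1 k).erase 1) (f := sumOverEnds F i)
      (g := fun l => numUnimodal l + numUnimodal l) fun l hl => by
        rw [sumOverEnds, if_neg (hne l hl hi'), hF, hF] <;>
          exact h0 l 1 hl (Finset.notMem_erase _ _),
    supportSeries_congr (S := ((Finset.Icc 1 k).erase 1).erase i) (f := sumOverEnds F i)
      (g := numUnimodal) fun l hl => by
        rw [sumOverEnds, if_pos (h0 l i hl (Finset.notMem_erase _ _)), hF]
        exact h0 l 1 hl (by simp),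
    supportSeries_add, supportSeries_add]
  ring

theorem series_eq_inv_mul {φ ψ χ : Series} (hφ : constantCoeff φ ≠ 0) (h : φ * χ = ψ) :
    χ = φ⁻¹ * ψ := by
  rw [← h, ← mul_assoc, MvPowerSeries.inv_mul_cancel _ hφ, one_mul]

theorem constantCoeff_one_sub_X_mul_ne_zero (i : ℕ) (φ : Series) :
    constantCoeff (1 - X i * φ) ≠ 0 := by
  simp

theorem constantCoeff_one_sub_X_ne_zero (i : ℕ) : constantCoeff (1 - X i : Series) ≠ 0 := by
  simp

theorem apply_zero_of_support (l : ℕ →₀ ℕ) (hl : l.support = Finset.Icc 1 k) : l 0 = 0 := by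
  rw [← Finsupp.notMem_support_iff, hl]
  simp

theorem apply_ne_zero_of_support {l : ℕ →₀ ℕ} (hl : l.support = Finset.Icc 1 k) (hi : 1 ≤ i)
    (hik : i ≤ k) : l i ≠ 0 := by
  rw [← Finsupp.mem_support_iff, hl]
  exact Finset.mem_Icc.2 ⟨hi, hik⟩

theorem genL_zero : genL 0 = 1 := by
  rw [genL_eq]
  ext l
  rw [coeff_supportSeries, coeff_one]
  simp only [Finset.Icc_eq_empty_of_lt zero_lt_one, Finsupp.support_eq_empty]
  split_ifs with hl
  · subst hl
    have : IsEmpty (BlockModel 0) := ⟨fun p => absurd p.2 (Nat.not_lt_zero _)⟩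
    have huniv : unimodalInvolutions (BlockModel.block : BlockModel 0 → ℕ) = Set.univ :=
      Set.eq_univ_of_forall fun π => ⟨fun x => isEmptyElim x, fun x => isEmptyElim x⟩
    rw [numUnimodal, huniv, Set.ncard_univ, Nat.card_unique, Nat.cast_one]
  · rfl

/-- The recurrence for `genL`, by the cycle of the least element. -/
theorem one_sub_X_mul_genL (hk : 1 ≤ k) :
    (1 - X 1) * genL k =
      X 1 ^ 2 * genLj k 1 + (X 1 + X 1 ^ 2) * hat 1 (genL (k - 1)) +
        ∑ i ∈ Finset.Icc 2 k, X 1 * X i *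
          (2 * hat 1 (genL (k - 1)) + hat i (genLj (k - 1) (i - 1)) +
            hat i (hat 1 (genL (k - 2))) + genLj k i + genLj k (i - 1)) := by
  have h1k : 1 ∈ Finset.Icc 1 k := Finset.mem_Icc.2 (by omega)
  -- the contribution of the 2-cycle formed by the ends of block `1`
  have htwo : supportSeries (Finset.Icc 1 k) (fun l => if (l - Finsupp.single 1 1 : ℕ →₀ ℕ) 1 = 0
      then 0 else numDecreasingOrBeyond 1 (l - Finsupp.single 1 1 - Finsupp.single 1 1)) =
        X 1 ^ 2 * (genLj k 1 + hat 1 (genL (k - 1))) := by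
    rw [← X_mul_supportSeries h1k fun l => if l 1 = 0 then 0 else
      numDecreasingOrBeyond 1 (l - Finsupp.single 1 1)]
    rw [supportSeries_congr (S := Finset.Icc 1 k)
        (g := fun l => numDecreasingOrBeyond 1 (l - Finsupp.single 1 1))
        fun l hl => if_neg (apply_ne_zero_of_support hl le_rfl hk),
      supportSeries_congr (S := (Finset.Icc 1 k).erase 1) (g := fun _ => 0)
        fun l hl => if_pos (by rw [← Finsupp.notMem_support_iff, hl]; simp),
      ← X_mul_supportSeries h1k, genLj_eq hk hk, hat_one_genL hk,
      supportSeries_congr (S := (Finset.Icc 1 k).erase 1) (f := numDecreasingOrBeyond 1)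
        (g := numUnimodal) fun l hl => numDecreasingOrBeyond_of_eq_zero
          (by rw [← Finsupp.notMem_support_iff, hl]; simp) 1]
    have : supportSeries ((Finset.Icc 1 k).erase 1) (fun _ => 0) = 0 := by
      ext l
      simp [coeff_supportSeries]
    rw [this]
    ring
  have hsum : genL k = X 1 * (genL k + hat 1 (genL (k - 1))) +
      X 1 ^ 2 * (genLj k 1 + hat 1 (genL (k - 1))) +
        ∑ i ∈ Finset.Icc 2 k, X 1 * X i *
          (2 * hat 1 (genL (k - 1)) + hat i (genLj (k - 1) (i - 1)) +
            hat i (hat 1 (genL (k - 2))) + genLj k i + genLj k (i - 1)) := by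
    have herase : (Finset.Icc 1 k).erase 1 = Finset.Icc 2 k := by
      ext x
      simp only [Finset.mem_erase, Finset.mem_Icc]
      omega
    rw [← htwo]
    conv_lhs => rw [genL_eq, supportSeries_congr fun l hl => (numUnimodal_eq
      (apply_zero_of_support l hl) (apply_ne_zero_of_support hl le_rfl hk)).trans (by
        rw [hl, herase]), supportSeries_add, supportSeries_add, supportSeries_sum]
    congr 1
    · rw [genL_eq, hat_one_genL hk, X_mul_supportSeries h1k]
    · refine Finset.sum_congr rfl fun i hi => ?_
      rw [Finset.mem_Icc] at hi
      rw [supportSeries_sumOverEnds hi.1 hi.2 fun j l h => numDecreasingOrBeyond_of_eq_zero h j,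
        genLj_eq hk hi.2, genLj_eq hk (by omega), hat_genLj hi.1 hi.2]
  linear_combination hsum

/-- The recurrence for `genLj`, by the block of the first value. -/
theorem genLj_eq_add_sum (hj : 1 ≤ j) (hjk : j ≤ k) :
    genLj k j = genD k j +
      ∑ i ∈ Finset.Icc (j + 1) k, X 1 * X i *
        (2 * hat 1 (genL (k - 1)) + hat i (genLj (k - 1) (i - 1)) +
          hat i (hat 1 (genL (k - 2))) + genLj k i + genLj k (i - 1)) := by
  have hk := hj.trans hjk
  have hfilter : (Finset.Icc 1 k).filter (j < ·) = Finset.Icc (j + 1) k := by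
    ext x
    simp only [Finset.mem_filter, Finset.mem_Icc]
    omega
  conv_lhs => rw [genLj_eq hk hjk, supportSeries_congr fun l hl => (numDecreasingOrBeyond_eq
    (apply_zero_of_support l hl) (apply_ne_zero_of_support hl le_rfl hk) hj).trans (by
      rw [hl, hfilter]), supportSeries_add, supportSeries_sum]
  rw [genD_eq hk hjk]
  congr 1
  refine Finset.sum_congr rfl fun i hi => ?_
  rw [Finset.mem_Icc] at hi
  rw [supportSeries_sumOverEnds (by omega) hi.2 fun j l h => numDecreasingOrBeyond_of_eq_zero h j,
    genLj_eq hk hi.2, genLj_eq hk (by omega), hat_genLj (by omega) hi.2]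

theorem genLj_self (hk : 1 ≤ k) : genLj k k = genD k k := by
  rw [genLj_eq_add_sum hk le_rfl, Finset.Icc_eq_empty_of_lt (Nat.lt_succ_self k),
    Finset.sum_empty, add_zero]

theorem one_sub_X_mul_genD_one (hk : 1 ≤ k) :
    (1 - X 1) * genD k 1 = X 1 * hat 1 (genL (k - 1)) := by
  have h1k : 1 ∈ Finset.Icc 1 k := Finset.mem_Icc.2 (by omega)
  have h : genD k 1 = X 1 * (genD k 1 + hat 1 (genL (k - 1))) := by
    have hhat : hat 1 (genL (k - 1)) =
        supportSeries ((Finset.Icc 1 k).erase 1) (numDecreasingWithin 1) := by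
      rw [hat_one_genL hk]
      exact supportSeries_congr fun l hl => (numDecreasingWithin_of_eq_zero
          (by rw [← Finsupp.notMem_support_iff, hl]; simp) 1).symm
    rw [hhat, genD_eq hk hk, X_mul_supportSeries h1k]
    refine supportSeries_congr fun l hl => ?_
    have h0 := apply_zero_of_support l hl
    have h1 := apply_ne_zero_of_support hl le_rfl hk
    rw [numDecreasingWithin_one h0, numDecreasingWithin_one (by simp [h0])]
    congr 1
    ext t
    by_cases ht : 1 = t
    · subst ht
      simp
    · simp [ht]
  linear_combination h

/-- The recurrence for `genD`, by whether the first value lies in block `i`. -/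
theorem genD_eq_add (hi : 1 < i) (hik : i ≤ k) :
    genD k i = genD k (i - 1) + X 1 * X i *
      (2 * hat 1 (genL (k - 1)) + hat i (genD (k - 1) (i - 1)) +
        hat i (hat 1 (genL (k - 2))) + genD k i + genD k (i - 1)) := by
  have hk : 1 ≤ k := by omega
  rw [genD_eq hk hik, genD_eq hk (show i - 1 ≤ k by omega), hat_genD hi hik,
    ← supportSeries_sumOverEnds hi hik fun j l h => numDecreasingWithin_of_eq_zero h j,
    ← supportSeries_add]
  exact supportSeries_congr fun l hl => numDecreasingWithin_eq (apply_zero_of_support l hl)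
    (apply_ne_zero_of_support hl le_rfl hk) hi (apply_ne_zero_of_support hl hi.le hik)

theorem genL_one : genL 1 = X 1 * ((1 - X 1) ^ 2)⁻¹ := by
  rw [MvPowerSeries.eq_mul_inv_iff_mul_eq (by simp)]
  have hhat : hat 1 (genL (1 - 1)) = 1 := by
    rw [genL_zero, hat, map_one]
  have hL := one_sub_X_mul_genL (k := 1) le_rfl
  have hD := one_sub_X_mul_genD_one (k := 1) le_rfl
  rw [genLj_self le_rfl, hhat, Finset.Icc_eq_empty_of_lt one_lt_two, Finset.sum_empty] at hL
  rw [hhat] at hD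
  linear_combination (1 - X 1) * hL + X 1 ^ 2 * hD

end GeneratingFunctions

end

open MvPowerSeries in
theorem theorem2 :
    genL 0 = 1 ∧
    genL 1 = X 1 * ((1 - X 1) ^ 2)⁻¹ ∧
    (∀ k : ℕ, 2 ≤ k →
      genL k = (1 - X 1)⁻¹ *
        (X 1 ^ 2 * genLj k 1 + (X 1 + X 1 ^ 2) * hat 1 (genL (k - 1)) +
          ∑ i ∈ Finset.Icc 2 k, X 1 * X i *
            (2 * hat 1 (genL (k - 1)) + hat i (genLj (k - 1) (i - 1)) +
              hat i (hat 1 (genL (k - 2))) + genLj k i + genLj k (i - 1)))) ∧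
    (∀ k : ℕ, 1 ≤ k → genLj k k = genD k k) ∧
    (∀ k j : ℕ, 1 ≤ j → j < k →
      genLj k j = (1 - X 1 * X (j + 1))⁻¹ *
        (genD k j + ∑ i ∈ Finset.Icc (j + 2) k, X 1 * X i * genLj k (i - 1) +
          ∑ i ∈ Finset.Icc (j + 1) k, X 1 * X i *
            (2 * hat 1 (genL (k - 1)) + hat i (genLj (k - 1) (i - 1)) +
              hat i (hat 1 (genL (k - 2))) + genLj k i))) ∧
    (∀ k : ℕ, 1 ≤ k → genD k 1 = X 1 * (1 - X 1)⁻¹ * hat 1 (genL (k - 1))) ∧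
    (∀ k i : ℕ, 1 < i → i ≤ k →
      genD k i = (1 - X 1 * X i)⁻¹ *
        (genD k (i - 1) + X 1 * X i *
          (genD k (i - 1) + hat i (genD (k - 1) (i - 1)) +
            hat i (hat 1 (genL (k - 2))) + 2 * hat 1 (genL (k - 1))))) := by
  refine ⟨genL_zero, genL_one, fun k hk => ?_, fun k => genLj_self, fun k j hj hjk => ?_,
    fun k hk => ?_, fun k i hi hik => ?_⟩
  · exact series_eq_inv_mul (constantCoeff_one_sub_X_ne_zero 1) (one_sub_X_mul_genL (by omega))
  · refine series_eq_inv_mul (constantCoeff_one_sub_X_mul_ne_zero 1 _) ?_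
    have hsplit : Finset.Icc (j + 1) k = insert (j + 1) (Finset.Icc (j + 2) k) := by
      ext x
      simp only [Finset.mem_insert, Finset.mem_Icc]
      omega
    -- the term `x_1 x_{j+1} L_j^k` of the recurrence has been moved to the left-hand side
    have hmove : ∑ i ∈ Finset.Icc (j + 1) k, X 1 * X i * genLj k (i - 1) =
        X 1 * X (j + 1) * genLj k j +
          ∑ i ∈ Finset.Icc (j + 2) k, X 1 * X i * genLj k (i - 1) := by
      rw [hsplit, Finset.sum_insert (by simp), Nat.add_sub_cancel]
    have hrec := genLj_eq_add_sum hj hjk.le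
    simp only [mul_add _ _ (genLj k (_ - 1)), Finset.sum_add_distrib, hmove] at hrec
    simp only [mul_add, Finset.sum_add_distrib] at hrec ⊢
    linear_combination hrec
  · rw [mul_right_comm, mul_comm]
    exact series_eq_inv_mul (constantCoeff_one_sub_X_ne_zero 1) (one_sub_X_mul_genD_one hk)
  · refine series_eq_inv_mul (constantCoeff_one_sub_X_mul_ne_zero 1 _) ?_
    linear_combination genD_eq_add hi hik
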